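/- Let $q$ be a power of a prime $p$, let $f,k$ be positive integers with $f\mid k$ and $\gcd(k/f,q-1)=1$, and let $a\in\mathbb F_q^*$. View $\mathbb F_q\subseteq\mathbb F_{q^f}\subseteq\mathbb F_{q^k}$, let $$D=\{x\in\mathbb F_{q^k}^*:\operatorname{Tr}_{q^f/q}(x^{\frac{q^k-1}{q^f-1}})+a=0\}=\{d_1,\dots,d_n\}$$ with $d_1,\dots,d_n$ distinct (in any order), and let $$\mathcal C_D=\{\mathbf c_b=(\operatorname{Tr}_{q^k/q}(bd_1),\dots,\operatorname{Tr}_{q^k/q}(bd_n)):b\in\mathbb F_{q^k}\}\subseteq\mathbb F_q^n .$$ An $[n,l,d]$ code over $\mathbb F_q$ is an $l$-dimensional subspace of $\mathbb F_q^n$ with minimum Hamming distance $d$; it is optimal if no $[n,l,d+1]$ code over $\mathbb F_q$ exists, and it achieves the Griesmer bound if $n=\sum_{i=0}^{l-1}\lceil d/q^i\rceil$. If $A_i$ is the number of codewords of Hamming weight $i$, the weight enumerator is $1+A_1z+\cdots+A_nz^n$, and the code is a $t$-weight code if exactly $t$ of $A_1,\dots,A_n$ are nonzero. (1) If $f=1$,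 then $\mathcal C_D$ is an optimal one-weight $\left[\frac{q^k-1}{q-1},k,q^{k-1}\right]$ code achieving the Griesmer bound. (2) If $f>1$, then $\mathcal C_D$ is a $$\left[\frac{q^{f-1}(q^k-1)}{q^f-1},\,k,\,d\right]\ \text{code with}\quad d\ge\frac{(q-1)q^{f+k-2}-(q^f-q)q^{\frac{k+f}2-2}}{q^f-1}.$$ Moreover, for every multiplicative character $\varphi$ of $\mathbb F_{q^f}$ of order $\frac{q^f-1}{q-1}$ and every $b\in\mathbb F_{q^k}^*$, the Hamming weight of $\mathbf c_b$ is $$w(\mathbf c_b)=\frac{(q-1)q^{f+k-2}}{q^f-1}+\frac{(-1)^{\frac kf-1}(q-1)q^{f-2}}{q^f-1}\sum_{j=1}^{\frac{q^f-1}{q-1}-1}\varphi^j(-1)\,G(\varphi^j,\chi_1)^{\frac kf-1}\,\overline{\varphi}^{\,j}\!\left(b^{\frac{q^k-1}{q^f-1}}\right),$$ where $\chi_1(x)=e^{2\pi i\operatorname{Tr}_{q^f/p}(x)/p}$ is the canonical additive character of $\mathbb F_{q^f}$ and $G(\psi,\chi_1)=\sum_{x\in\mathbb F_{q^f}^*}\psi(x)\chi_1(x)$.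 (3) If $f=2$ and $k\equiv0\pmod 4$, then $\mathcal C_D$ is a two-weight $\left[\frac{q(q^k-1)}{q^2-1},k,\frac{q^k-q^{k/2}}{q+1}\right]$ code with weight enumerator $$1+\frac{q^k-1}{q+1}z^{\frac{q^k-q^{k/2}}{q+1}}+\frac{q(q^k-1)}{q+1}z^{\frac{q^k+q^{k/2-1}}{q+1}}.$$ (4) If $f=2$ and $k\equiv2\pmod 4$, then $\mathcal C_D$ is a two-weight $\left[\frac{q(q^k-1)}{q^2-1},k,\frac{q^k-q^{k/2-1}}{q+1}\right]$ code with weight enumerator $$1+\frac{q(q^k-1)}{q+1}z^{\frac{q^k-q^{k/2-1}}{q+1}}+\frac{q^k-1}{q+1}z^{\frac{q^k+q^{k/2}}{q+1}}.$$ -/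

import Mathlib

open Polynomial

noncomputable section

namespace TraceCode

section Codes

variable {F ι : Type*} [Field F] [Fintype F] [DecidableEq F] [Fintype ι]

/-- `C` is an `[n, l, d]` linear code over `F`: its length is `n`, its dimension is `l`, and `d` is
the minimum Hamming distance between two distinct codewords. -/
def IsLinearCode (C : Submodule F (ι → F)) (n l d : ℕ) : Prop :=
  Fintype.card ι = n ∧ Module.finrank F C = l ∧
    IsLeast {m : ℕ | ∃ u ∈ C, ∃ v ∈ C, u ≠ v ∧ hammingDist u v = m} d

/-- An `[n, l, d]` linear code over `F` is optimal if no `[n, l, d + 1]` linear code over `F`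
exists. -/
def IsOptimalCode (C : Submodule F (ι → F)) (n l d : ℕ) : Prop :=
  IsLinearCode C n l d ∧ ¬ ∃ C' : Submodule F (Fin n → F), IsLinearCode C' n l (d + 1)

/-- An `[n, l, d]` linear code over `F` achieves the Griesmer bound
`n ≥ ∑_{i = 0}^{l - 1} ⌈d / q ^ i⌉`, where `q = |F|`. -/
def AchievesGriesmer (C : Submodule F (ι → F)) (n l d : ℕ) : Prop :=
  IsLinearCode C n l d ∧
    n = ∑ i ∈ Finset.range l, ⌈(d : ℚ) / (Fintype.card F : ℚ) ^ i⌉₊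

/-- `A_i`: the number of codewords of `C` of Hamming weight `i`. -/
def weightCount (C : Submodule F (ι → F)) (i : ℕ) : ℕ :=
  Set.ncard {c : ι → F | c ∈ C ∧ hammingNorm c = i}

/-- The weight enumerator `1 + A_1 z + ⋯ + A_n z ^ n`. -/
def weightEnumerator (C : Submodule F (ι → F)) : ℕ[X] :=
  1 + ∑ i ∈ Finset.Icc 1 (Fintype.card ι), weightCount C i • X ^ i

/-- `C` is a `t`-weight code: exactly `t` of the numbers `A_1, …, A_n` are nonzero. -/
def IsWeightCode (C : Submodule F (ι → F)) (t : ℕ) : Prop :=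
  ((Finset.Icc 1 (Fintype.card ι)).filter fun i => weightCount C i ≠ 0).card = t

end Codes

section DefiningSet

variable (F : Type*) {L ι : Type*} [Field F] [Field L] [Algebra F L]

/-- The codeword `c_b = (Tr(b d_1), …, Tr(b d_n))`, as a linear function of `b`. -/
def codeword (d : ι → L) : L →ₗ[F] (ι → F) :=
  LinearMap.pi fun i => Algebra.trace F L ∘ₗ LinearMap.mulRight F (d i)

/-- The code `{(Tr(x d_1), …, Tr(x d_n)) : x ∈ L}` with defining set `{d_1, …, d_n}`. -/
def code (d : ι → L) : Submodule F (ι → F) :=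
  LinearMap.range (codeword F d)

theorem codeword_apply (d : ι → L) (b : L) (i : ι) :
    codeword F d b i = Algebra.trace F L (b * d i) := rfl

/-- The set of nonzero `x ∈ L` with `Tr_{K/F} (x ^ ((|L| - 1) / (|K| - 1))) + a = 0`; here
`x ^ ((|L| - 1) / (|K| - 1))` lies in the subfield `K` of `L`, and `y` is that element of `K`. -/
def definingSet (K : Type*) [Field K] [Algebra F K] [Algebra K L] [Fintype K] [Fintype L]
    (a : F) : Set L :=
  {x : L | x ≠ 0 ∧ ∃ y : K,
    algebraMap K L y = x ^ ((Fintype.card L - 1) / (Fintype.card K - 1)) ∧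
      Algebra.trace F K y + a = 0}

end DefiningSet

/-- The canonical additive character `x ↦ exp (2 π i Tr(x) / p)` of a finite field `K` of
characteristic `p`, where `Tr` is the trace from `K` to its prime field. -/
def canonicalAddChar (K : Type*) [Field K] [Fintype K] : AddChar K ℂ :=
  haveI : NeZero (ringChar K) := ⟨CharP.ringChar_ne_zero_of_finite K⟩
  haveI : Fact (ringChar K).Prime := ⟨CharP.char_is_prime K (ringChar K)⟩
  letI : Algebra (ZMod (ringChar K)) K := ZMod.algebra K (ringChar K)
  (ZMod.stdAddChar (N := ringChar K)).compAddMonoidHom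
    (Algebra.trace (ZMod (ringChar K)) K).toAddMonoidHom

end TraceCode

end

/-!
The weights are computed with characters of the intermediate field `K`. Put `m = [L : K]`, let `N`
be the norm from `L` to `K`, and `Tr` the trace from `K` to `F`. The exponent
`(|L| - 1) / (|K| - 1)` is that of the norm, so the defining set is `{x | Tr (N x) = -a}`. A scalar
`c ∈ Fˣ` multiplies `Tr (N x)` by `c ^ m`, and `c ↦ c ^ m` is a bijection of `Fˣ` because `m` is
prime to `q - 1`. Counting over the defining set is therefore, up to the factor `q - 1`, counting
over all `x` with `Tr (N x) ≠ 0` (`card_mul_card_filter_definingSet`), and with additive characters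
the weight of `c_b` becomes an exponential sum over these `x` (`card_mul_weight_eq`).

The condition `Tr (N x) ≠ 0` is expanded in multiplicative characters `θ` of `K`
(`sum_trace_norm_ne_zero`). Only the `θ` that are trivial on `Fˣ` contribute, and for `θ ≠ 1` their
coefficients are multiples of the Gauss sums `G(θ⁻¹)` over `K` (`card_mul_sum_trace_ne_zero`). The
sums of `θ (N x) ψ (Tr (b x))` over `x ∈ L`, where now `Tr` is the trace from `L` to `F`, are
`±θ⁻¹(N b) G(θ) ^ m` by the Davenport–Hasse relation (`davenportHasse`), and
`G(θ) G(θ⁻¹) = θ(-1) |K|` gives the weight formula `weight_eq`. It holds for every degree `[K : F]`: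
* for `K = F` the only character trivial on `Fˣ` is the trivial one, all nonzero codewords have
  weight `q ^ (k - 1)`, and optimality follows from the Plotkin bound;
* in general `|G(θ)| = √|K|` bounds the weights from below, which also shows that `b ↦ c_b` is
  injective;
* for `[K : F] = 2` the Gauss sums are `q θ(y₀)`, where `y₀ ≠ 0` has trace zero
  (`gaussSum_of_finrank_eq_two`), and orthogonality leaves two weights, according to whether
  `y₀ ^ (m - 1) / N b` lies in `F`.

The Davenport–Hasse relation is proved with the `L`-function `∑ λ(P) T ^ deg P` over the monic
polynomials `P` over `K`, where `λ(X ^ n - c₁ X ^ (n - 1) + ⋯ + (-1) ^ n cₙ) = θ(cₙ) ψ(c₁)`. It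
equals `1 + G(θ) T`, and its logarithmic derivative has as coefficients the sums of
`d λ(P) ^ (s / d)` over the irreducible `P` of degree `d ∣ s`, which are the Gauss sums over the
extensions of `K`. Comparing coefficients is Newton's identity `nat_mul_polyCharSum`.
-/

noncomputable section

namespace TraceCode

/-! ### The Davenport–Hasse relation -/

section DavenportHasse

variable (K : Type*) [Field K]

section

variable [Fintype K]

theorem finite_monic_natDegree (n : ℕ) : {P : K[X] | P.Monic ∧ P.natDegree = n}.Finite := by
  refine Set.Finite.of_injOn (f := fun P : K[X] => fun i : Fin (n + 1) => P.coeff i)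
    (t := Set.univ) (fun _ _ => Set.mem_univ _) ?_ Set.finite_univ
  rintro P ⟨-, hP⟩ Q ⟨-, hQ⟩ h
  ext i
  by_cases hi : i < n + 1
  · exact congrFun h ⟨i, hi⟩
  · rw [coeff_eq_zero_of_natDegree_lt (by omega), coeff_eq_zero_of_natDegree_lt (by omega)]

/-- The monic polynomials of degree `n` over a finite field. -/
def monicPolys (n : ℕ) : Finset K[X] := (finite_monic_natDegree K n).toFinset

variable {K}

@[simp]
theorem mem_monicPolys {n : ℕ} {P : K[X]} : P ∈ monicPolys K n ↔ P.Monic ∧ P.natDegree = n := by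
  simp [monicPolys]

end

variable {K}

/-- The completely multiplicative function on monic polynomials sending
`X ^ n - c₁ X ^ (n - 1) + ⋯ + (-1) ^ n cₙ` to `θ cₙ * ψ c₁`. -/
def polyChar (θ : MulChar K ℂ) (ψ : AddChar K ℂ) (P : K[X]) : ℂ :=
  θ ((-1) ^ P.natDegree * P.coeff 0) * ψ (-P.nextCoeff)

variable (θ : MulChar K ℂ) (ψ : AddChar K ℂ)

@[simp]
theorem polyChar_one : polyChar θ ψ 1 = 1 := by
  have : (1 : K[X]).nextCoeff = 0 := nextCoeff_C_eq_zero 1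
  simp [polyChar, this]

theorem polyChar_mul {P Q : K[X]} (hP : P.Monic) (hQ : Q.Monic) :
    polyChar θ ψ (P * Q) = polyChar θ ψ P * polyChar θ ψ Q := by
  have h : (-1 : K) ^ (P.natDegree + Q.natDegree) * (P.coeff 0 * Q.coeff 0)
      = ((-1) ^ P.natDegree * P.coeff 0) * ((-1) ^ Q.natDegree * Q.coeff 0) := by ring
  rw [polyChar, polyChar, polyChar, hP.natDegree_mul hQ, mul_coeff_zero, hP.nextCoeff_mul hQ,
    neg_add, AddChar.map_add_eq_mul, h, map_mul]
  ring

theorem polyChar_pow {P : K[X]} (hP : P.Monic) (j : ℕ) :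
    polyChar θ ψ (P ^ j) = polyChar θ ψ P ^ j := by
  induction j with
  | zero => simp
  | succ j ih => rw [pow_succ, polyChar_mul θ ψ (hP.pow j) hP, ih, pow_succ]

/-- The characteristic polynomial of `x` over `K` is the power of its minimal polynomial with
exponent `[L : K(x)]`, so norm and trace of `x` are read off from the minimal polynomial. -/
theorem char_norm_mul_char_trace {L : Type*} [Field L] [Finite L] [Algebra K L] (x : L) :
    θ (Algebra.norm K x) * ψ (Algebra.trace K L x)
      = polyChar θ ψ (minpoly K x) ^ (Module.finrank K L / (minpoly K x).natDegree) := by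
  have hx : IsIntegral K x := Algebra.IsIntegral.isIntegral x
  have hr : Module.finrank (IntermediateField.adjoin K {x}) L
      = Module.finrank K L / (minpoly K x).natDegree := by
    rw [← IntermediateField.adjoin.finrank hx, ← Module.finrank_mul_finrank K
      (IntermediateField.adjoin K {x}) L, Nat.mul_div_cancel_left _ Module.finrank_pos]
  rw [trace_eq_finrank_mul_minpoly_nextCoeff, Algebra.norm_eq_norm_adjoin, hr, map_pow,
    ← nsmul_eq_mul, AddChar.map_nsmul_eq_pow, ← mul_pow, polyChar]
  have := Algebra.PowerBasis.norm_gen_eq_coeff_zero_minpoly (IntermediateField.adjoin.powerBasis hx)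
  rw [IntermediateField.adjoin.powerBasis_gen, IntermediateField.minpoly_gen,
    IntermediateField.adjoin.powerBasis_dim] at this
  rw [this]

variable [Fintype K]

/-- The coefficient of `T ^ n` in the `L`-function `∑ P, polyChar θ ψ P * T ^ deg P`, the sum
running over the monic polynomials `P`. -/
def polyCharSum (n : ℕ) : ℂ := ∑ P ∈ monicPolys K n, polyChar θ ψ P

theorem polyCharSum_zero : polyCharSum θ ψ 0 = 1 := by
  have : monicPolys K 0 = {1} := by
    ext P
    simp only [mem_monicPolys, Finset.mem_singleton]
    exact ⟨fun h => h.1.natDegree_eq_zero.mp h.2, by rintro rfl; simp⟩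
  simp [polyCharSum, this]

theorem polyCharSum_one : polyCharSum θ ψ 1 = gaussSum θ ψ := by
  rw [polyCharSum, gaussSum]
  refine (Finset.sum_bij (fun (c : K) _ => X - C c) ?_ ?_ ?_ ?_).symm
  · intro c _; simp [monic_X_sub_C]
  · intro c _ c' _ h; simpa using h
  · intro P hP
    rw [mem_monicPolys] at hP
    exact ⟨-P.coeff 0, Finset.mem_univ _, by
      rw [map_neg, sub_neg_eq_add]; exact (hP.1.eq_X_add_C hP.2).symm⟩
  · intro c _
    simp [polyChar]

/-- The `L`-function has degree at most one: translating the coefficient of `X ^ (n - 1)`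
multiplies the sum by a value of `ψ`. -/
theorem polyCharSum_eq_zero (hψ : ψ ≠ 1) {n : ℕ} (hn : 2 ≤ n) : polyCharSum θ ψ n = 0 := by
  obtain ⟨c, hc⟩ := AddChar.ne_one_iff.mp hψ
  have key : ∀ e : K, ∀ P ∈ monicPolys K n, P + C e * X ^ (n - 1) ∈ monicPolys K n := by
    intro e P hP
    rw [mem_monicPolys] at hP ⊢
    have hlt : (C e * X ^ (n - 1) : K[X]).degree < P.degree := by
      rw [degree_eq_natDegree hP.1.ne_zero, hP.2]
      exact (degree_C_mul_X_pow_le _ _).trans_lt (by exact_mod_cast (by omega : n - 1 < n))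
    exact ⟨hP.1.add_of_left hlt, by rw [natDegree_add_eq_left_of_degree_lt hlt, hP.2]⟩
  have h : polyCharSum θ ψ n = ψ c * polyCharSum θ ψ n := by
    conv_rhs => rw [polyCharSum, Finset.mul_sum]
    rw [polyCharSum]
    refine (Finset.sum_bij' (fun P _ => P + C (-c) * X ^ (n - 1))
      (fun P _ => P + C c * X ^ (n - 1)) (key _) (key _) ?_ ?_ ?_).symm
    · intro P _; simp
    · intro P _; simp
    · intro P hP
      have hP' := key (-c) P hP
      rw [mem_monicPolys] at hP hP'
      rw [polyChar, polyChar, hP.2, hP'.2, nextCoeff_of_natDegree_pos (by omega),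
        nextCoeff_of_natDegree_pos (by omega), hP.2, hP'.2, coeff_add, coeff_add,
        coeff_C_mul_X_pow, coeff_C_mul_X_pow, if_neg (by omega), if_pos rfl, add_zero, neg_add,
        neg_neg, AddChar.map_add_eq_mul]
      ring
  have : (1 - ψ c) * polyCharSum θ ψ n = 0 := by rw [sub_mul, one_mul, ← h, sub_self]
  exact (mul_eq_zero.mp this).resolve_left (sub_ne_zero.mpr (Ne.symm hc))

variable (K) in
open Classical in
/-- The pairs `(j, P)` with `j ≥ 1` and `P` monic irreducible such that `P ^ j` has degree `s`. The
bounds on `j` and `deg P`, automatic for `s ≥ 1`, make this a finset. -/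
def primePowers (s : ℕ) : Finset (ℕ × K[X]) :=
  (Finset.Icc 1 s ×ˢ (Finset.range (s + 1)).biUnion (monicPolys K)).filter
    fun x => Irreducible x.2 ∧ x.1 * x.2.natDegree = s

theorem mem_primePowers {s : ℕ} (hs : 1 ≤ s) {x : ℕ × K[X]} : x ∈ primePowers K s ↔
    x.2.Monic ∧ Irreducible x.2 ∧ x.1 * x.2.natDegree = s := by
  classical
  rw [primePowers, Finset.mem_filter, Finset.mem_product, Finset.mem_Icc, Finset.mem_biUnion]
  constructor
  · rintro ⟨⟨-, d, -, h⟩, h'⟩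
    exact ⟨(mem_monicPolys.mp h).1, h'⟩
  · rintro ⟨h1, h2, h3⟩
    have hd := h2.natDegree_pos
    have hj : 1 ≤ x.1 := by
      rcases Nat.eq_zero_or_pos x.1 with h | h
      · rw [h, zero_mul] at h3; omega
      · exact h
    refine ⟨⟨⟨hj, by nlinarith⟩, x.2.natDegree, Finset.mem_range.mpr (by nlinarith), ?_⟩, h2, h3⟩
    simp [h1]

open Classical in
/-- Counting the degree of a monic polynomial through the prime powers dividing it. -/
theorem natDegree_eq_sum_primePowers {P : K[X]} (hP : P.Monic) :
    P.natDegree = ∑ s ∈ Finset.Icc 1 P.natDegree, ∑ x ∈ primePowers K s,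
      if x.2 ^ x.1 ∣ P then x.2.natDegree else 0 := by
  have h0 := hP.ne_zero
  set T := UniqueFactorizationMonoid.normalizedFactors P with hT
  have hTmem : ∀ Q ∈ T, Q.Monic ∧ Irreducible Q ∧ Q ∣ P := fun Q hQ => by
    have hirr := UniqueFactorizationMonoid.irreducible_of_normalized_factor Q hQ
    refine ⟨?_, hirr, UniqueFactorizationMonoid.dvd_of_mem_normalizedFactors hQ⟩
    rw [← UniqueFactorizationMonoid.normalize_normalized_factor Q hQ]
    exact monic_normalize hirr.ne_zero
  have hprod : T.prod = P := by
    rw [hT, UniqueFactorizationMonoid.prod_normalizedFactors_eq h0, hP.normalize_eq_self]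
  have hdvd : ∀ Q ∈ T, ∀ j, Q ^ j ∣ P ↔ j ≤ T.count Q := by
    intro Q hQ j
    have h := UniqueFactorizationMonoid.emultiplicity_eq_count_normalizedFactors
      (hTmem Q hQ).2.1 h0
    rw [pow_dvd_iff_le_emultiplicity, h, (hTmem Q hQ).1.normalize_eq_self, Nat.cast_le]
  have hbound : ∀ Q ∈ T, ∀ j, Q ^ j ∣ P → j * Q.natDegree ≤ P.natDegree := by
    intro Q hQ j hj
    rw [← natDegree_pow]
    exact natDegree_le_of_dvd hj h0
  -- the prime powers dividing `P`
  set U := ((Finset.Icc 1 P.natDegree ×ˢ T.toFinset).filter fun x => x.2 ^ x.1 ∣ P) with hU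
  have h1 : P.natDegree = ∑ x ∈ U, x.2.natDegree := by
    rw [hU, Finset.sum_filter, Finset.sum_product_right]
    conv_lhs => rw [← hprod, natDegree_multiset_prod_of_monic _ fun Q hQ => (hTmem Q hQ).1,
      Finset.sum_multiset_map_count]
    refine Finset.sum_congr rfl fun Q hQ => ?_
    rw [Multiset.mem_toFinset] at hQ
    have hfil : (Finset.Icc 1 P.natDegree).filter (fun j => Q ^ j ∣ P)
        = Finset.Icc 1 (T.count Q) := by
      ext j
      simp only [Finset.mem_filter, Finset.mem_Icc, hdvd Q hQ j]
      refine ⟨fun h => ⟨h.1.1, h.2⟩, fun h => ⟨⟨h.1, ?_⟩, h.2⟩⟩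
      have := hbound Q hQ j ((hdvd Q hQ j).mpr h.2)
      nlinarith [(hTmem Q hQ).2.1.natDegree_pos]
    rw [← Finset.sum_filter, hfil]
    simp
  have hmaps : ∀ x ∈ U, x.1 * x.2.natDegree ∈ Finset.Icc 1 P.natDegree := by
    intro x hx
    simp only [hU, Finset.mem_filter, Finset.mem_product, Finset.mem_Icc,
      Multiset.mem_toFinset] at hx ⊢
    exact ⟨Nat.mul_pos hx.1.1.1 (hTmem _ hx.1.2).2.1.natDegree_pos, hbound _ hx.1.2 _ hx.2⟩
  conv_lhs => rw [h1, ← Finset.sum_fiberwise_of_maps_to hmaps]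
  refine Finset.sum_congr rfl fun s hs => ?_
  rw [← Finset.sum_filter]
  refine Finset.sum_congr ?_ fun _ _ => rfl
  rw [Finset.mem_Icc] at hs
  ext x
  simp only [hU, Finset.mem_filter, mem_primePowers hs.1, Finset.mem_product, Finset.mem_Icc,
    Multiset.mem_toFinset]
  constructor
  · rintro ⟨⟨⟨h2, h3⟩, h4⟩, h5⟩
    exact ⟨⟨(hTmem _ h3).1, (hTmem _ h3).2.1, h5⟩, h4⟩
  · rintro ⟨⟨h2, h3, h5⟩, h4⟩
    have hj : 1 ≤ x.1 := by
      rcases Nat.eq_zero_or_pos x.1 with h | h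
      · rw [h, zero_mul] at h5; omega
      · exact h
    have hd := h3.natDegree_pos
    refine ⟨⟨⟨⟨hj, by nlinarith⟩, ?_⟩, h4⟩, h5⟩
    exact (UniqueFactorizationMonoid.mem_normalizedFactors_iff' h0).mpr
      ⟨h3, h2.normalize_eq_self, (dvd_pow_self _ (by omega)).trans h4⟩

/-- The coefficients of the logarithmic derivative of the `L`-function: the sum of
`deg P * polyChar P ^ j` over the prime powers `P ^ j` of degree `s`. -/
def primePowerSum (s : ℕ) : ℂ :=
  ∑ x ∈ primePowers K s, x.2.natDegree * polyChar θ ψ x.2 ^ x.1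

/-- Newton's identity relating the `L`-function to its logarithmic derivative. -/
theorem nat_mul_polyCharSum (n : ℕ) : n * polyCharSum θ ψ n
    = ∑ s ∈ Finset.Icc 1 n, primePowerSum θ ψ s * polyCharSum θ ψ (n - s) := by
  classical
  calc n * polyCharSum θ ψ n
      = ∑ P ∈ monicPolys K n, ∑ s ∈ Finset.Icc 1 n, ∑ x ∈ primePowers K s,
          (if x.2 ^ x.1 ∣ P then x.2.natDegree * polyChar θ ψ P else 0) := by
        rw [polyCharSum, Finset.mul_sum]
        refine Finset.sum_congr rfl fun P hP => ?_
        rw [mem_monicPolys] at hP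
        have h := natDegree_eq_sum_primePowers hP.1
        rw [hP.2] at h
        conv_lhs => rw [h]
        push_cast
        simp only [Finset.sum_mul, ite_mul, zero_mul]
    _ = _ := by
        rw [Finset.sum_comm]
        refine Finset.sum_congr rfl fun s hs => ?_
        rw [Finset.sum_comm, primePowerSum, Finset.sum_mul]
        refine Finset.sum_congr rfl fun x hx => ?_
        rw [Finset.mem_Icc] at hs
        rw [mem_primePowers hs.1] at hx
        obtain ⟨hm, hi, hd⟩ := hx
        rw [← Finset.sum_filter, polyCharSum, Finset.mul_sum]
        have hmj := hm.pow x.1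
        symm
        refine Finset.sum_bij (fun R _ => x.2 ^ x.1 * R) ?_ ?_ ?_ ?_
        · intro R hR
          rw [mem_monicPolys] at hR
          rw [Finset.mem_filter, mem_monicPolys]
          refine ⟨⟨hmj.mul hR.1, ?_⟩, dvd_mul_right _ _⟩
          rw [hmj.natDegree_mul hR.1, natDegree_pow, hR.2, hd]; omega
        · intro R _ R' _ h
          exact mul_left_cancel₀ hmj.ne_zero h
        · intro P hP
          rw [Finset.mem_filter, mem_monicPolys] at hP
          obtain ⟨⟨h1, h2⟩, R, rfl⟩ := hP
          have hR := hmj.of_mul_monic_left h1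
          refine ⟨R, ?_, rfl⟩
          rw [hmj.natDegree_mul hR, natDegree_pow, hd] at h2
          rw [mem_monicPolys]
          exact ⟨hR, by omega⟩
        · intro R hR
          rw [mem_monicPolys] at hR
          rw [polyChar_mul θ ψ hmj hR.1, polyChar_pow θ ψ hm]; ring

/-- As the `L`-function is `1 + G T`, its logarithmic derivative is a geometric series. -/
theorem primePowerSum_eq (hψ : ψ ≠ 1) (s : ℕ) :
    primePowerSum θ ψ (s + 1) = (-1) ^ s * gaussSum θ ψ ^ (s + 1) := by
  induction s with
  | zero =>
    have h := nat_mul_polyCharSum θ ψ 1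
    simpa [polyCharSum_zero, polyCharSum_one] using h.symm
  | succ s ih =>
    have h := nat_mul_polyCharSum θ ψ (s + 1 + 1)
    rw [polyCharSum_eq_zero θ ψ hψ (by omega), Finset.sum_Icc_succ_top (by omega),
      Finset.sum_Icc_succ_top (by omega), Finset.sum_eq_zero, Nat.sub_self,
      Nat.add_sub_cancel_left, polyCharSum_zero, polyCharSum_one, ih] at h
    · linear_combination -h
    · intro t ht
      rw [Finset.mem_Icc] at ht
      rw [polyCharSum_eq_zero θ ψ hψ (by omega), mul_zero]

variable {L : Type*} [Field L] [Fintype L] [Algebra K L]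

/-- A monic irreducible polynomial whose degree divides `[L : K]` splits in `L` with distinct
roots. -/
theorem card_minpoly_fiber [DecidableEq K[X]] {P : K[X]} (hP : P.Monic) (hirr : Irreducible P)
    (hdvd : P.natDegree ∣ Module.finrank K L) :
    (Finset.univ.filter fun x : L => minpoly K x = P).card = P.natDegree := by
  have : Fact (Irreducible P) := ⟨hirr⟩
  have hsep : P.Separable := PerfectField.separable_of_irreducible hirr
  have : Module.finrank K (AdjoinRoot P) = P.natDegree :=
    finrank_quotient_span_eq_natDegree (f := P)
  have hfin : Module.Finite K (AdjoinRoot P) := hP.finite_adjoinRoot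
  obtain ⟨g⟩ := FiniteField.nonempty_algHom_of_finrank_dvd (F := K) (K := AdjoinRoot P) (L := L)
    (by rwa [this])
  have hroot : aeval (g (AdjoinRoot.root P)) P = 0 := by
    rw [aeval_algHom_apply, AdjoinRoot.aeval_eq, AdjoinRoot.mk_self, map_zero]
  have hmin := minpoly.eq_of_irreducible_of_monic hirr hroot hP
  have hsplit : (P.map (algebraMap K L)).Splits := by
    rw [hmin]; exact Normal.splits inferInstance _
  rw [← card_rootSet_eq_natDegree hsep hsplit, ← Set.toFinset_card]
  congr 1
  ext x
  rw [Finset.mem_filter, Set.mem_toFinset, mem_rootSet]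
  simp only [Finset.mem_univ, true_and]
  constructor
  · rintro rfl; exact ⟨hP.ne_zero, minpoly.aeval K x⟩
  · rintro ⟨-, h⟩; exact (minpoly.eq_of_irreducible_of_monic hirr h hP).symm

/-- The **Davenport–Hasse lifting relation**: up to sign, the Gauss sum over `L` of the lifted
characters is the `[L : K]`-th power of the Gauss sum over `K`. -/
theorem davenportHasse (hψ : ψ ≠ 1) :
    ∑ x : L, θ (Algebra.norm K x) * ψ (Algebra.trace K L x)
      = (-1) ^ (Module.finrank K L - 1) * gaussSum θ ψ ^ Module.finrank K L := by
  classical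
  obtain ⟨s, hs⟩ := Nat.exists_eq_add_one.mpr (Module.finrank_pos (R := K) (M := L))
  have hdeg : ∀ x : L, (minpoly K x).natDegree ∣ Module.finrank K L := fun x =>
    minpoly.degree_dvd (Algebra.IsIntegral.isIntegral x)
  rw [hs, Nat.add_sub_cancel, ← primePowerSum_eq θ ψ hψ, ← hs, primePowerSum]
  have hpos := Module.finrank_pos (R := K) (M := L)
  have hmaps : ∀ x ∈ (Finset.univ : Finset L), ((Module.finrank K L / (minpoly K x).natDegree,
      minpoly K x) : ℕ × K[X]) ∈ primePowers K (Module.finrank K L) := fun x _ =>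
    (mem_primePowers hpos).mpr ⟨minpoly.monic (Algebra.IsIntegral.isIntegral x),
      minpoly.irreducible (Algebra.IsIntegral.isIntegral x), Nat.div_mul_cancel (hdeg x)⟩
  rw [← Finset.sum_fiberwise_of_maps_to hmaps]
  refine Finset.sum_congr rfl fun y hy => ?_
  obtain ⟨hm, hi, hd⟩ := (mem_primePowers hpos).mp hy
  have hfil : (Finset.univ.filter fun x : L => ((Module.finrank K L / (minpoly K x).natDegree,
      minpoly K x) : ℕ × K[X]) = y) = Finset.univ.filter fun x : L => minpoly K x = y.2 := by
    ext x
    simp only [Finset.mem_filter, Finset.mem_univ, true_and]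
    refine ⟨fun h => by rw [← h], fun h => Prod.ext ?_ h⟩
    simp only [h]
    exact Nat.div_eq_of_eq_mul_left hi.natDegree_pos hd.symm
  rw [hfil, Finset.sum_congr rfl (g := fun _ => polyChar θ ψ y.2 ^ y.1), Finset.sum_const,
    card_minpoly_fiber hm hi ⟨y.1, by rw [← hd, mul_comm]⟩, nsmul_eq_mul]
  intro x hx
  rw [Finset.mem_filter] at hx
  rw [char_norm_mul_char_trace, hx.2, Nat.div_eq_of_eq_mul_left hi.natDegree_pos hd.symm]

end DavenportHasse

/-! ### Character sums over trace and norm -/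

section CharacterSums

variable (F K L : Type*) [Field F] [Fintype F] [Field K] [Fintype K] [Field L] [Fintype L]
  [Algebra F K] [Algebra K L] [Algebra F L] [IsScalarTower F K L]

instance : Fintype (MulChar K ℂ) := Fintype.ofFinite _

variable {K} in
theorem sum_mulChar_apply [DecidableEq K] {v : K} (hv : v ≠ 0) :
    ∑ θ : MulChar K ℂ, θ v = if v = 1 then (Fintype.card K : ℂ) - 1 else 0 := by
  split_ifs with h
  · subst h
    have hc : Fintype.card (MulChar K ℂ) = Fintype.card K - 1 := by
      rw [← Nat.card_eq_fintype_card, MulChar.card_eq_card_units_of_hasEnoughRootsOfUnity,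
        Nat.card_eq_fintype_card, Fintype.card_units]
    simp only [MulChar.map_one, Finset.sum_const, Finset.card_univ, hc, nsmul_eq_mul, mul_one]
    rw [Nat.cast_sub Fintype.card_pos, Nat.cast_one]
  · obtain ⟨χ, hχ⟩ := MulChar.exists_apply_ne_one_of_hasEnoughRootsOfUnity K ℂ h
    have h1 : χ v * ∑ θ : MulChar K ℂ, θ v = ∑ θ : MulChar K ℂ, θ v := by
      rw [Finset.mul_sum]
      exact Fintype.sum_bijective _ (Group.mulLeft_bijective χ) _ _ fun θ => rfl
    have h2 : (χ v - 1) * ∑ θ : MulChar K ℂ, θ v = 0 := by rw [sub_mul, h1, one_mul, sub_self]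
    exact (mul_eq_zero.mp h2).resolve_left (sub_ne_zero.mpr hχ)

variable {K} in
theorem sum_mulChar_inv_mul [DecidableEq K] {y : K} (hy : y ≠ 0) (u : K) :
    ∑ θ : MulChar K ℂ, θ⁻¹ y * θ u = if u = y then (Fintype.card K : ℂ) - 1 else 0 := by
  by_cases hu : u = 0
  · subst hu
    rw [if_neg (Ne.symm hy)]
    exact Finset.sum_eq_zero fun θ _ => by rw [MulChar.map_zero, mul_zero]
  · have h := sum_mulChar_apply (mul_ne_zero (inv_ne_zero hy) hu)
    simp only [map_mul, ← MulChar.inv_apply'] at h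
    rw [h]
    refine if_congr ?_ rfl rfl
    rw [inv_mul_eq_one₀ hy, eq_comm]

open Classical in
/-- The multiplicative characters of `K` that are trivial on `Fˣ`. -/
def trivialOnBase : Finset (MulChar K ℂ) :=
  Finset.univ.filter fun θ => ∀ c : F, c ≠ 0 → θ (algebraMap F K c) = 1

variable {F K} in
theorem mem_trivialOnBase {θ : MulChar K ℂ} :
    θ ∈ trivialOnBase F K ↔ ∀ c : F, c ≠ 0 → θ (algebraMap F K c) = 1 := by
  simp [trivialOnBase]

variable {F} in
/-- The additive character `ψ ∘ Tr` of an extension. -/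
def traceChar (ψ : AddChar F ℂ) : AddChar K ℂ :=
  ψ.compAddMonoidHom (Algebra.trace F K).toAddMonoidHom

variable {F} (ψ : AddChar F ℂ)

omit [Fintype F] [Fintype K] in
@[simp]
theorem traceChar_apply (x : K) : traceChar K ψ x = ψ (Algebra.trace F K x) := rfl

variable {ψ}

theorem traceChar_ne_one (hψ : ψ ≠ 1) : traceChar K ψ ≠ 1 := by
  obtain ⟨c, hc⟩ := AddChar.ne_one_iff.mp hψ
  obtain ⟨x, rfl⟩ := Algebra.trace_surjective F K c
  exact AddChar.ne_one_iff.mpr ⟨x, hc⟩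

theorem sum_addChar_mul [DecidableEq F] (hψ : ψ ≠ 1) (s : F) :
    ∑ t : F, ψ (t * s) = if s = 0 then (Fintype.card F : ℂ) else 0 := by
  have := AddChar.sum_mulShift s (AddChar.IsPrimitive.of_ne_one hψ)
  rw [this]
  split_ifs <;> simp

/-- The sum of `η` over the elements of nonzero trace, in terms of a Gauss sum. The factor
`∑ η⁻¹(t)` over `t ∈ Fˣ` vanishes unless `η` is trivial on `Fˣ`. -/
theorem card_mul_sum_trace_ne_zero [DecidableEq F] (hψ : ψ ≠ 1) (η : MulChar K ℂ) :
    (Fintype.card F : ℂ) * ∑ y : K with Algebra.trace F K y ≠ 0, η y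
      = ((Fintype.card F : ℂ) - 1) * ∑ y, η y
        - (∑ t : F with t ≠ 0, η⁻¹ (algebraMap F K t)) * gaussSum η (traceChar K ψ) := by
  have h1 : ∀ t : F, t ≠ 0 → ∑ y : K, η y * ψ (t * Algebra.trace F K y)
      = η⁻¹ (algebraMap F K t) * gaussSum η (traceChar K ψ) := by
    intro t ht
    have h := gaussSum_mulShift_eq η (traceChar K ψ)
      (Units.mk0 (algebraMap F K t) (by simpa using ht))
    rw [Units.val_mk0] at h
    rw [← h, gaussSum]
    refine Finset.sum_congr rfl fun y _ => ?_
    rw [AddChar.mulShift_apply, traceChar_apply, ← Algebra.smul_def, map_smul, smul_eq_mul]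
  have h2 : ∑ t : F, ∑ y : K, η y * ψ (t * Algebra.trace F K y)
      = ∑ y, η y + (∑ t : F with t ≠ 0, η⁻¹ (algebraMap F K t))
        * gaussSum η (traceChar K ψ) := by
    rw [← Finset.sum_filter_add_sum_filter_not _ (fun t : F => t = 0),
      Finset.filter_eq' _ (0 : F), if_pos (Finset.mem_univ _), Finset.sum_singleton,
      Finset.sum_mul]
    congr 1
    · simp
    · exact Finset.sum_congr rfl fun t ht => h1 t (Finset.mem_filter.mp ht).2
  have h3 : ∑ t : F, ∑ y : K, η y * ψ (t * Algebra.trace F K y)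
      = (Fintype.card F : ℂ) * ∑ y : K with Algebra.trace F K y = 0, η y := by
    rw [Finset.sum_comm, Finset.mul_sum, Finset.sum_filter]
    refine Finset.sum_congr rfl fun y _ => ?_
    rw [← Finset.mul_sum, sum_addChar_mul hψ]
    split_ifs <;> ring
  have h4 := Finset.sum_filter_add_sum_filter_not Finset.univ
    (fun y : K => Algebra.trace F K y = 0) (fun y => η y)
  rw [h2] at h3
  simp only [← ne_eq] at h4
  linear_combination h3 + (Fintype.card F : ℂ) * h4

omit [Fintype F] [Algebra F L] [IsScalarTower F K L] in
variable {L} in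
/-- Fourier expansion over the characters of `K` of a sum over the elements of `L` whose norm has
nonzero trace. -/
theorem sum_trace_norm_ne_zero [DecidableEq F] (g : L → ℂ) :
    ((Fintype.card K : ℂ) - 1) * ∑ x : L with Algebra.trace F K (Algebra.norm K x) ≠ 0, g x
      = ∑ θ : MulChar K ℂ, (∑ y : K with Algebra.trace F K y ≠ 0, θ⁻¹ y)
          * ∑ x : L, θ (Algebra.norm K x) * g x := by
  classical
  simp only [Finset.sum_mul_sum]
  rw [Finset.sum_comm]
  have h : ∀ y ∈ Finset.univ.filter (fun y : K => Algebra.trace F K y ≠ 0),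
      ∑ θ : MulChar K ℂ, ∑ x : L, θ⁻¹ y * (θ (Algebra.norm K x) * g x)
        = ∑ x : L, if Algebra.norm K x = y then ((Fintype.card K : ℂ) - 1) * g x else 0 := by
    intro y hy
    have hy0 : y ≠ 0 := by
      rintro rfl
      simp at hy
    rw [Finset.sum_comm]
    refine Finset.sum_congr rfl fun x _ => ?_
    simp only [← mul_assoc, ← Finset.sum_mul]
    rw [sum_mulChar_inv_mul hy0]
    split_ifs <;> simp
  rw [Finset.sum_congr rfl h, Finset.sum_comm, Finset.mul_sum, Finset.sum_filter]
  refine Finset.sum_congr rfl fun x _ => ?_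
  rw [Finset.sum_ite_eq]
  simp

variable {L} in
/-- The Davenport–Hasse relation for a twisted character. -/
theorem sum_norm_mul_trace (hψ : ψ ≠ 1) (θ : MulChar K ℂ) {b : L} (hb : b ≠ 0) :
    ∑ x : L, θ (Algebra.norm K x) * ψ (Algebra.trace F L (b * x))
      = θ⁻¹ (Algebra.norm K b) * ((-1) ^ (Module.finrank K L - 1)
        * gaussSum θ (traceChar K ψ) ^ Module.finrank K L) := by
  rw [← davenportHasse (L := L) θ _ (traceChar_ne_one K hψ), Finset.mul_sum]
  refine Fintype.sum_bijective _ (mulLeft_bijective₀ b hb) _ _ fun x => ?_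
  have hNb : Algebra.norm K b ≠ 0 := Algebra.norm_ne_zero_iff.mpr hb
  have h : θ (Algebra.norm K x)
      = θ⁻¹ (Algebra.norm K b) * θ (Algebra.norm K (b * x)) := by
    rw [MulChar.inv_apply', ← map_mul, map_mul (Algebra.norm K), inv_mul_cancel_left₀ hNb]
  rw [traceChar_apply, Algebra.trace_trace, h, mul_assoc]

omit [Fintype K] in
theorem sum_norm (θ : MulChar K ℂ) (hθ : θ ≠ 1) : ∑ x : L, θ (Algebra.norm K x) = 0 := by
  obtain ⟨y, hy⟩ := MulChar.ne_one_iff.mp hθ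
  obtain ⟨z, hz⟩ := FiniteField.norm_surjective K L y
  have hz0 : z ≠ 0 := by
    rintro rfl
    exact y.ne_zero (by rw [← hz, Algebra.norm_zero])
  have h1 : θ y * ∑ x : L, θ (Algebra.norm K x) = ∑ x : L, θ (Algebra.norm K x) := by
    rw [Finset.mul_sum]
    exact Fintype.sum_bijective _ (mulLeft_bijective₀ z hz0) _ _ fun x => by
      rw [map_mul, map_mul, hz]
  have h2 : (θ y - 1) * ∑ x : L, θ (Algebra.norm K x) = 0 := by rw [sub_mul, h1, one_mul, sub_self]
  exact (mul_eq_zero.mp h2).resolve_left (sub_ne_zero.mpr hy)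

theorem sum_one_mulChar : ∑ y : K, (1 : MulChar K ℂ) y = (Fintype.card K : ℂ) - 1 := by
  classical
  rw [MulChar.sum_one_eq_card_units, Fintype.card_units, Nat.cast_sub Fintype.card_pos,
    Nat.cast_one]

variable (F) in
/-- The canonical additive character of an extension of `F` factors through the trace to `F`. -/
theorem exists_canonicalAddChar_eq :
    ∃ ψ : AddChar F ℂ, ψ ≠ 1 ∧ canonicalAddChar K = traceChar K ψ := by
  have : NeZero (ringChar K) := ⟨CharP.ringChar_ne_zero_of_finite K⟩
  have : Fact (ringChar K).Prime := ⟨CharP.char_is_prime K (ringChar K)⟩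
  have : CharP F (ringChar K) := by rw [← Algebra.ringChar_eq F K]; infer_instance
  let _ : Algebra (ZMod (ringChar K)) K := ZMod.algebra K (ringChar K)
  let _ : Algebra (ZMod (ringChar K)) F := ZMod.algebra F (ringChar K)
  have : IsScalarTower (ZMod (ringChar K)) F K :=
    IsScalarTower.of_algebraMap_eq' (Subsingleton.elim _ _)
  refine ⟨traceChar F (ZMod.stdAddChar (N := ringChar K)), traceChar_ne_one F ?_, ?_⟩
  · refine AddChar.ne_one_iff.mpr ⟨1, fun h => one_ne_zero (α := ZMod (ringChar K)) ?_⟩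
    exact ZMod.injective_stdAddChar (h.trans (AddChar.map_zero_eq_one _).symm)
  · ext x
    rw [traceChar_apply, traceChar_apply, Algebra.trace_trace]
    rfl

theorem card_mul_card_trace_ne_zero [DecidableEq F] (hψ : ψ ≠ 1) :
    (Fintype.card F : ℂ) * ∑ y : K with Algebra.trace F K y ≠ 0, (1 : MulChar K ℂ) y
      = ((Fintype.card F : ℂ) - 1) * Fintype.card K := by
  have h : ∀ t ∈ Finset.univ.filter (fun t : F => t ≠ 0),
      (1 : MulChar K ℂ)⁻¹ (algebraMap F K t) = 1 := fun t ht => by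
    rw [inv_one, MulChar.one_apply]
    simpa using ht
  rw [card_mul_sum_trace_ne_zero K hψ, sum_one_mulChar, Finset.sum_congr rfl h,
    gaussSum_one_left (traceChar_ne_one K hψ), Finset.sum_const, Finset.filter_ne',
    Finset.card_erase_of_mem (Finset.mem_univ _), Finset.card_univ, nsmul_eq_mul,
    Nat.cast_sub Fintype.card_pos]
  push_cast
  ring

omit [Algebra F L] [IsScalarTower F K L] in
/-- The number of elements of `L` whose norm to `K` has nonzero trace in `F`. -/
theorem card_trace_norm_ne_zero [DecidableEq F] (hψ : ψ ≠ 1) :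
    (Fintype.card F : ℂ) * (((Fintype.card K : ℂ) - 1)
        * (Finset.univ.filter fun x : L => Algebra.trace F K (Algebra.norm K x) ≠ 0).card)
      = ((Fintype.card F : ℂ) - 1) * Fintype.card K * ((Fintype.card L : ℂ) - 1) := by
  have h := sum_trace_norm_ne_zero (F := F) K (L := L) (fun _ => 1)
  simp only [mul_one, Finset.sum_const, nsmul_eq_mul] at h
  rw [h, Finset.sum_eq_single (1 : MulChar K ℂ), inv_one, ← mul_assoc,
    card_mul_card_trace_ne_zero K hψ]
  · congr 1
    have h1 : ∀ x : L, (1 : MulChar K ℂ) (Algebra.norm K x) = (1 : MulChar L ℂ) x := by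
      intro x
      by_cases hx : x = 0
      · rw [hx, Algebra.norm_zero, MulChar.map_zero, MulChar.map_zero]
      · rw [MulChar.one_apply (by simpa using hx), MulChar.one_apply
          (by simpa [Algebra.norm_eq_zero_iff] using hx)]
    simp only [h1]
    exact sum_one_mulChar L
  · intro θ _ hθ
    rw [sum_norm K L θ hθ, mul_zero]
  · simp

/-- The exponential sum that governs the weight of the codeword `c_b`: only the characters trivial
on `Fˣ` contribute, and the trivial character gives the summand `1`. -/
theorem expSum_trace_norm_ne_zero [DecidableEq F] [DecidableEq (MulChar K ℂ)] (hψ : ψ ≠ 1)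
    {b : L} (hb : b ≠ 0) :
    (Fintype.card F : ℂ) * (((Fintype.card K : ℂ) - 1)
        * ∑ x : L with Algebra.trace F K (Algebra.norm K x) ≠ 0, ψ (Algebra.trace F L (b * x)))
      = -(((Fintype.card F : ℂ) - 1) * Fintype.card K * (1 + (-1) ^ (Module.finrank K L - 1)
        * ∑ θ ∈ (trivialOnBase F K).erase 1, θ (-1)
          * gaussSum θ (traceChar K ψ) ^ (Module.finrank K L - 1) * θ⁻¹ (Algebra.norm K b))) := by
  rw [sum_trace_norm_ne_zero]
  have hm := Module.finrank_pos (R := K) (M := L)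
  obtain ⟨m, hm⟩ := Nat.exists_eq_add_one.mpr hm
  simp only [sum_norm_mul_trace K hψ _ hb, hm, Nat.add_sub_cancel]
  rw [Finset.mul_sum, ← Finset.add_sum_erase _ _ (Finset.mem_univ (1 : MulChar K ℂ))]
  have hz : ∀ θ : MulChar K ℂ, θ ∉ trivialOnBase F K →
      ∑ t : F with t ≠ 0, θ (algebraMap F K t) = 0 := by
    intro θ hθ
    rw [mem_trivialOnBase] at hθ
    push Not at hθ
    obtain ⟨c, hc, hθc⟩ := hθ
    have hfil : ∀ g : F → ℂ, g 0 = 0 → ∑ t : F with t ≠ 0, g t = ∑ t : F, g t := fun g hg => by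
      rw [Finset.sum_filter_of_ne]
      rintro t - ht rfl
      exact ht hg
    rw [hfil _ (by rw [map_zero, MulChar.map_zero])]
    have h1 : θ (algebraMap F K c) * ∑ t : F, θ (algebraMap F K t)
        = ∑ t : F, θ (algebraMap F K t) := by
      rw [Finset.mul_sum]
      exact Fintype.sum_bijective _ (mulLeft_bijective₀ c hc) _ _ fun x => by
        rw [map_mul, map_mul]
    have h2 : (θ (algebraMap F K c) - 1) * ∑ t : F, θ (algebraMap F K t) = 0 := by
      rw [sub_mul, h1, one_mul, sub_self]
    exact (mul_eq_zero.mp h2).resolve_left (sub_ne_zero.mpr hθc)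
  have hsub : (trivialOnBase F K).erase 1 ⊆ (Finset.univ : Finset (MulChar K ℂ)).erase 1 :=
    Finset.erase_subset_erase _ (Finset.subset_univ _)
  rw [← Finset.sum_subset hsub, inv_one, ← mul_assoc, card_mul_card_trace_ne_zero K hψ,
    gaussSum_one_left (traceChar_ne_one K hψ), MulChar.one_apply
      (by simpa [Algebra.norm_eq_zero_iff] using hb), mul_add, neg_add, mul_one,
      Finset.mul_sum, Finset.mul_sum, ← Finset.sum_neg_distrib]
  · congr 1
    · have h1 : (-1 : ℂ) ^ m * (-1) ^ m = 1 := by rw [← mul_pow]; norm_num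
      rw [pow_succ, one_mul]
      linear_combination (-((Fintype.card F : ℂ) - 1) * Fintype.card K) * h1
    · refine Finset.sum_congr rfl fun θ hθ => ?_
      rw [Finset.mem_erase, mem_trivialOnBase] at hθ
      have hθi : θ⁻¹ ≠ 1 := inv_ne_one.mpr hθ.1
      -- the coefficient of `θ` brings in `G(θ⁻¹)`, which cancels one factor of `G(θ) ^ (m + 1)`
      have hg : gaussSum θ (traceChar K ψ) * gaussSum θ⁻¹ (traceChar K ψ)
          = θ (-1) * Fintype.card K := by
        have h1 := gaussSum_mul_gaussSum_eq_card hθ.1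
          (AddChar.IsPrimitive.of_ne_one (traceChar_ne_one K hψ))
        have h2 := mul_gaussSum_inv_eq_gaussSum θ⁻¹ (traceChar K ψ)
        have h3 : θ⁻¹ (-1) = θ (-1) := by rw [MulChar.inv_apply', inv_neg_one]
        rw [← h2, h3, mul_left_comm, h1]
      have hone : ∑ t : F with t ≠ 0, θ (algebraMap F K t) = (Fintype.card F : ℂ) - 1 := by
        rw [Finset.sum_congr rfl fun t ht => hθ.2 t (Finset.mem_filter.mp ht).2,
          Finset.sum_const, Finset.filter_ne', Finset.card_erase_of_mem (Finset.mem_univ _),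
          Finset.card_univ, nsmul_eq_mul, Nat.cast_sub Fintype.card_pos]
        simp
      rw [← mul_assoc, card_mul_sum_trace_ne_zero K hψ, MulChar.sum_eq_zero_of_ne_one hθi, inv_inv,
        hone, pow_succ]
      linear_combination (-((Fintype.card F : ℂ) - 1) * θ⁻¹ (Algebra.norm K b) * (-1) ^ m
        * gaussSum θ (traceChar K ψ) ^ m) * hg
  · intro θ hθ hθ'
    rw [Finset.mem_erase] at hθ
    have hθ'' : θ ∉ trivialOnBase F K := fun h => hθ' (Finset.mem_erase.mpr ⟨hθ.1, h⟩)
    rw [← mul_assoc, card_mul_sum_trace_ne_zero K hψ,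
      MulChar.sum_eq_zero_of_ne_one (inv_ne_one.mpr hθ.1), inv_inv, hz θ hθ'']
    ring

end CharacterSums

/-! ### Characters trivial on the base field -/

section TrivialOnBase

variable (F K : Type*) [Field F] [Fintype F] [Field K] [Fintype K] [Algebra F K]

theorem one_mem_trivialOnBase : (1 : MulChar K ℂ) ∈ trivialOnBase F K := by
  rw [mem_trivialOnBase]
  intro c hc
  exact MulChar.one_apply (by simpa using hc)

variable {K} in
/-- Orthogonality of the characters trivial on `Fˣ`: they separate `Fˣ` from its complement. -/
theorem sum_trivialOnBase_apply_eq_zero {v : K} (hv : v ∉ Set.range (algebraMap F K)) :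
    ∑ θ ∈ trivialOnBase F K, θ v = 0 := by
  have hv0 : v ≠ 0 := by
    rintro rfl
    exact hv ⟨0, map_zero _⟩
  obtain ⟨χ, hχ, hχv⟩ : ∃ χ ∈ trivialOnBase F K, χ v ≠ 1 := by
    by_contra! hall
    let H : Subgroup Kˣ := (Units.map (algebraMap F K : F →* K)).range
    have h1 : Units.mk0 v hv0 ∈ H := by
      rw [← (MulChar.subgroupOrderIsoSubgroupMulChar K ℂ).symm_apply_apply H]
      refine MulChar.mem_subgroupOrderIsoSubgroupMulChar_symm_iff.mpr fun χ hχ => ?_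
      have hχ' := MulChar.mem_subgroupOrderIsoSubgroupMulChar_iff.mp hχ
      refine hall χ (mem_trivialOnBase.mpr fun c hc => ?_)
      exact hχ' _ ⟨Units.mk0 c hc, rfl⟩
    obtain ⟨c, hc⟩ := h1
    exact hv ⟨c, congrArg Units.val hc⟩
  have h1 : χ v * ∑ θ ∈ trivialOnBase F K, θ v = ∑ θ ∈ trivialOnBase F K, θ v := by
    rw [Finset.mul_sum]
    refine Finset.sum_bij' (fun θ _ => χ * θ) (fun θ _ => χ⁻¹ * θ) ?_ ?_ ?_ ?_ ?_
    · intro θ hθ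
      rw [mem_trivialOnBase] at hθ hχ ⊢
      intro c hc
      rw [MulChar.mul_apply, hχ c hc, hθ c hc, one_mul]
    · intro θ hθ
      rw [mem_trivialOnBase] at hθ hχ ⊢
      intro c hc
      rw [MulChar.mul_apply, MulChar.inv_apply', ← map_inv₀, hχ _ (inv_ne_zero hc), hθ c hc,
        one_mul]
    · intro θ _; exact inv_mul_cancel_left χ θ
    · intro θ _; exact mul_inv_cancel_left χ θ
    · intro θ _; rfl
  have h2 : (χ v - 1) * ∑ θ ∈ trivialOnBase F K, θ v = 0 := by
    rw [sub_mul, h1, one_mul, sub_self]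
  exact (mul_eq_zero.mp h2).resolve_left (sub_ne_zero.mpr hχv)

/-- The number of characters trivial on `Fˣ` is the index of `Fˣ` in `Kˣ`; it is obtained by
evaluating `∑ θ(v)` over all `θ` and `v` in both orders. -/
theorem card_trivialOnBase_mul :
    (trivialOnBase F K).card * (Fintype.card F - 1) = Fintype.card K - 1 := by
  classical
  have h1 : ∑ v : K, ∑ θ ∈ trivialOnBase F K, θ v = (Fintype.card K : ℂ) - 1 := by
    rw [Finset.sum_comm, Finset.sum_eq_single (1 : MulChar K ℂ), sum_one_mulChar]
    · intro θ _ hθ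
      exact MulChar.sum_eq_zero_of_ne_one hθ
    · intro h
      exact absurd (one_mem_trivialOnBase F K) h
  have h2 : ∑ v : K, ∑ θ ∈ trivialOnBase F K, θ v
      = ∑ c : F, ∑ θ ∈ trivialOnBase F K, θ (algebraMap F K c) := by
    rw [← Finset.sum_image (s := Finset.univ) (g := algebraMap F K)
      (f := fun v => ∑ θ ∈ trivialOnBase F K, θ v) (algebraMap F K).injective.injOn]
    refine (Finset.sum_subset (Finset.subset_univ _) fun v _ hv =>
      sum_trivialOnBase_apply_eq_zero F fun ⟨c, hc⟩ => hv ?_).symm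
    exact Finset.mem_image.mpr ⟨c, Finset.mem_univ _, hc⟩
  have h3 : ∑ c : F, ∑ θ ∈ trivialOnBase F K, θ (algebraMap F K c)
      = ((Fintype.card F : ℂ) - 1) * (trivialOnBase F K).card := by
    rw [← Finset.add_sum_erase _ _ (Finset.mem_univ (0 : F)), Finset.sum_eq_zero, zero_add,
      Finset.sum_congr rfl (g := fun _ => ((trivialOnBase F K).card : ℂ)), Finset.sum_const,
      Finset.card_erase_of_mem (Finset.mem_univ _), Finset.card_univ, nsmul_eq_mul,
      Nat.cast_sub Fintype.card_pos, Nat.cast_one]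
    · intro c hc
      rw [Finset.sum_congr rfl fun θ hθ =>
        mem_trivialOnBase.mp hθ c (Finset.ne_of_mem_erase hc)]
      simp
    · intro θ _
      rw [map_zero, MulChar.map_zero]
  rw [h2, h3] at h1
  have h4 : (((trivialOnBase F K).card * (Fintype.card F - 1) : ℕ) : ℂ)
      = ((Fintype.card K - 1 : ℕ) : ℂ) := by
    rw [Nat.cast_mul, Nat.cast_sub Fintype.card_pos, Nat.cast_sub Fintype.card_pos]
    push_cast
    rw [← h1]; ring
  exact_mod_cast h4

variable {K} in
/-- A character `φ` of order `[Kˣ : Fˣ]` is trivial on `Fˣ`, which consists of the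
`[Kˣ : Fˣ]`-th powers in `Kˣ`, so its powers are all the characters trivial on `Fˣ`. -/
theorem sum_trivialOnBase_erase_eq_sum_pow [DecidableEq (MulChar K ℂ)] {φ : MulChar K ℂ}
    (hφ : orderOf φ = (Fintype.card K - 1) / (Fintype.card F - 1)) (g : MulChar K ℂ → ℂ) :
    ∑ θ ∈ (trivialOnBase F K).erase 1, g θ
      = ∑ j ∈ Finset.Icc 1 ((Fintype.card K - 1) / (Fintype.card F - 1) - 1), g (φ ^ j) := by
  have hq : 0 < Fintype.card F - 1 := Nat.sub_pos_of_lt Fintype.one_lt_card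
  have hcard : (trivialOnBase F K).card = (Fintype.card K - 1) / (Fintype.card F - 1) := by
    rw [← card_trivialOnBase_mul F K, Nat.mul_div_cancel _ hq]
  rw [← hcard] at hφ ⊢
  have hinj : Set.InjOn (fun j => φ ^ j)
      (Finset.Icc 1 ((trivialOnBase F K).card - 1) : Finset ℕ) := by
    intro i hi j hj h
    simp only [Finset.coe_Icc, Set.mem_Icc] at hi hj
    exact pow_injOn_Iio_orderOf (Set.mem_Iio.mpr (by omega)) (Set.mem_Iio.mpr (by omega)) h
  rw [← Finset.sum_image (s := Finset.Icc 1 ((trivialOnBase F K).card - 1))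
    (g := fun j => φ ^ j) (f := g) hinj]
  refine (Finset.sum_congr (Finset.eq_of_subset_of_card_le ?_ ?_) fun _ _ => rfl).symm
  · intro θ hθ
    obtain ⟨j, hj, rfl⟩ := Finset.mem_image.mp hθ
    rw [Finset.mem_Icc] at hj
    refine Finset.mem_erase.mpr ⟨?_, mem_trivialOnBase.mpr fun c hc => ?_⟩
    · exact pow_ne_one_of_lt_orderOf (by omega) (by omega)
    · obtain ⟨y, rfl⟩ := FiniteField.norm_surjective F K c
      have hy : y ≠ 0 := by
        rintro rfl
        exact hc (Algebra.norm_zero ..)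
      rw [FiniteField.algebraMap_norm_eq_pow, Nat.card_eq_fintype_card, Nat.card_eq_fintype_card,
        ← card_trivialOnBase_mul F K, Nat.mul_div_cancel _ hq, map_pow,
        ← MulChar.pow_apply' _ (by omega), ← pow_mul, mul_comm, pow_mul, ← hφ, pow_orderOf_eq_one,
        one_pow, MulChar.one_apply hy.isUnit]
  · rw [Finset.card_image_of_injOn hinj, Finset.card_erase_of_mem (one_mem_trivialOnBase F K),
      Nat.card_Icc]
    omega

variable {F K} {ψ : AddChar F ℂ}

theorem norm_gaussSum {θ : MulChar K ℂ} (hθ : θ ≠ 1) {η : AddChar K ℂ} (hη : η ≠ 1) :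
    ‖gaussSum θ η‖ = √(Fintype.card K) := by
  have h := gaussSum_mul_gaussSum_eq_card hθ (AddChar.IsPrimitive.of_ne_one hη)
  rw [← star_gaussSum_eq, ← starRingEnd_apply, Complex.mul_conj'] at h
  rw [← Real.sqrt_sq (norm_nonneg (gaussSum θ η))]
  congr 1
  exact_mod_cast h

theorem norm_sum_trivialOnBase_le [DecidableEq (MulChar K ℂ)] (hψ : ψ ≠ 1) (m : ℕ) (z : K) :
    ‖∑ θ ∈ (trivialOnBase F K).erase 1, θ (-1) * gaussSum θ (traceChar K ψ) ^ m * θ⁻¹ z‖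
      ≤ ((trivialOnBase F K).card - 1) * √(Fintype.card K) ^ m := by
  classical
  have hle : ∀ (θ : MulChar K ℂ) (u : K), ‖θ u‖ ≤ 1 := by
    intro θ u
    by_cases hu : u = 0
    · rw [hu, MulChar.map_zero]; simp
    · have h := MulChar.apply_mem_rootsOfUnity (χ := θ) (Units.mk0 u hu)
      have h1 := Complex.norm_eq_one_of_mem_rootsOfUnity h
      exact h1.le
  refine (norm_sum_le _ _).trans ?_
  refine (Finset.sum_le_sum (g := fun _ => √(Fintype.card K : ℝ) ^ m) fun θ hθ => ?_).trans ?_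
  · rw [norm_mul, norm_mul, norm_pow,
      norm_gaussSum (Finset.ne_of_mem_erase hθ) (traceChar_ne_one K hψ)]
    have h0 : (0 : ℝ) ≤ √(Fintype.card K) ^ m := by positivity
    calc _ ≤ 1 * √(Fintype.card K : ℝ) ^ m * 1 := by
          gcongr
          · exact hle _ _
          · exact hle _ _
      _ = _ := by ring
  · rw [Finset.sum_const, Finset.card_erase_of_mem (one_mem_trivialOnBase F K), nsmul_eq_mul,
      Nat.cast_sub (Finset.card_pos.mpr ⟨1, one_mem_trivialOnBase F K⟩), Nat.cast_one]

/-- For a quadratic extension the Gauss sum of a character trivial on `Fˣ` is evaluated at an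
element of trace zero. -/
theorem gaussSum_of_finrank_eq_two (hψ : ψ ≠ 1) (hf : Module.finrank F K = 2) {y₀ : K}
    (hy₀ : y₀ ≠ 0) (htr : Algebra.trace F K y₀ = 0) {θ : MulChar K ℂ} (hθ : θ ≠ 1)
    (hθF : θ ∈ trivialOnBase F K) :
    gaussSum θ (traceChar K ψ) = Fintype.card F * θ y₀ := by
  classical
  have h := card_mul_sum_trace_ne_zero K hψ θ
  have hq : (Fintype.card F : ℂ) - 1 ≠ 0 := by
    rw [sub_ne_zero]
    exact_mod_cast (Fintype.one_lt_card (α := F)).ne'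
  have hcount : ((Fintype.card F - 1 : ℕ) : ℂ) = (Fintype.card F : ℂ) - 1 := by
    rw [Nat.cast_sub Fintype.card_pos, Nat.cast_one]
  rw [mem_trivialOnBase] at hθF
  have hone : ∑ t : F with t ≠ 0, θ⁻¹ (algebraMap F K t) = (Fintype.card F : ℂ) - 1 := by
    rw [Finset.sum_congr rfl (g := fun _ => 1), Finset.sum_const, Finset.filter_ne',
      Finset.card_erase_of_mem (Finset.mem_univ _), Finset.card_univ, nsmul_eq_mul, mul_one,
      hcount]
    intro t ht
    rw [MulChar.inv_apply', ← map_inv₀]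
    exact hθF _ (inv_ne_zero (Finset.mem_filter.mp ht).2)
  have hker : ∀ y : K, Algebra.trace F K y = 0 → ∃ c : F, c • y₀ = y := by
    intro y hy
    have h1 := (Algebra.trace F K).finrank_range_add_finrank_ker
    rw [LinearMap.range_eq_top.mpr (Algebra.trace_surjective F K), finrank_top,
      Module.finrank_self, hf] at h1
    have h2 : Module.finrank F (LinearMap.ker (Algebra.trace F K)) = 1 := by omega
    have h3 : (⟨y₀, htr⟩ : LinearMap.ker (Algebra.trace F K)) ≠ 0 := fun h =>
      hy₀ (congrArg Subtype.val h)
    obtain ⟨c, hc⟩ := (finrank_eq_one_iff_of_nonzero' _ h3).mp h2 ⟨y, hy⟩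
    exact ⟨c, congrArg Subtype.val hc⟩
  have hzero : ∑ y : K with Algebra.trace F K y = 0, θ y = ((Fintype.card F : ℂ) - 1) * θ y₀ := by
    have : ∑ y : K with Algebra.trace F K y = 0, θ y = ∑ c : F, θ (c • y₀) := by
      refine (Finset.sum_bij (fun (c : F) _ => c • y₀) ?_ ?_ ?_ ?_).symm
      · intro c _; simp [htr]
      · intro c _ c' _ hcc; exact smul_left_injective F hy₀ hcc
      · intro y hy
        obtain ⟨c, hc⟩ := hker y (Finset.mem_filter.mp hy).2
        exact ⟨c, Finset.mem_univ _, hc⟩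
      · intro c _; rfl
    rw [this, ← Finset.add_sum_erase _ _ (Finset.mem_univ (0 : F)), zero_smul, MulChar.map_zero,
      zero_add, Finset.sum_congr rfl (g := fun _ => θ y₀), Finset.sum_const,
      Finset.card_erase_of_mem (Finset.mem_univ _), Finset.card_univ, nsmul_eq_mul, hcount]
    intro c hc
    rw [Algebra.smul_def, map_mul, hθF c (Finset.ne_of_mem_erase hc), one_mul]
  have hsum := Finset.sum_filter_add_sum_filter_not Finset.univ
    (fun y : K => Algebra.trace F K y = 0) (fun y => θ y)
  simp only [← ne_eq] at hsum
  rw [hone, MulChar.sum_eq_zero_of_ne_one hθ] at h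
  rw [MulChar.sum_eq_zero_of_ne_one hθ, hzero] at hsum
  apply mul_left_cancel₀ hq
  linear_combination h - (Fintype.card F : ℂ) * hsum

end TrivialOnBase

/-! ### The weights of the codewords -/

section Weights

variable {F K L : Type*} [Field F] [Fintype F] [DecidableEq F] [Field K] [Fintype K] [Field L]
  [Fintype L] [Algebra F K] [Algebra K L] [Algebra F L] [IsScalarTower F K L]

omit [Fintype F] [DecidableEq F] [Algebra F L] [IsScalarTower F K L] in
/-- The power of `x` in the definition of the defining set is its norm; the condition `x ≠ 0`
follows from `a ≠ 0`. -/
theorem mem_definingSet_iff {a : F} (ha : a ≠ 0) {x : L} :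
    x ∈ definingSet F K a ↔ Algebra.trace F K (Algebra.norm K x) = -a := by
  have hN : algebraMap K L (Algebra.norm K x)
      = x ^ ((Fintype.card L - 1) / (Fintype.card K - 1)) := by
    rw [FiniteField.algebraMap_norm_eq_pow, Nat.card_eq_fintype_card, Nat.card_eq_fintype_card]
  rw [← add_eq_zero_iff_eq_neg]
  constructor
  · rintro ⟨-, y, hy, h⟩
    rwa [← (algebraMap K L).injective (hy.trans hN.symm)]
  · intro h
    refine ⟨?_, _, hN, h⟩
    rintro rfl
    rw [Algebra.norm_zero, map_zero, zero_add] at h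
    exact ha h

omit [DecidableEq F] [Fintype F] [Fintype K] in
theorem trace_norm_smul (c : F) (x : L) : Algebra.trace F K (Algebra.norm K (c • x))
    = c ^ Module.finrank K L * Algebra.trace F K (Algebra.norm K x) := by
  rw [Algebra.smul_def, IsScalarTower.algebraMap_apply F K L, map_mul, Algebra.norm_algebraMap,
    ← map_pow, ← Algebra.smul_def, map_smul, smul_eq_mul]

omit [DecidableEq F] in
theorem exists_pow_eq_of_coprime {m : ℕ} (hm : Nat.gcd m (Fintype.card F - 1) = 1) {s : F}
    (hs : s ≠ 0) : ∃ c : F, c ≠ 0 ∧ c ^ m = s := by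
  classical
  have hco : (Nat.card Fˣ).Coprime m := by
    rw [Nat.card_units, Nat.card_eq_fintype_card, Nat.coprime_comm]
    exact hm
  obtain ⟨u, hu⟩ := (powCoprime hco).surjective (Units.mk0 s hs)
  exact ⟨u, u.ne_zero, by simpa using congrArg Units.val hu⟩

/-- The scalars `c ∈ Fˣ` permute the fibres of `Tr ∘ N` over `Fˣ` transitively, so counting over the
defining set amounts to counting over all elements whose norm has nonzero trace. -/
theorem card_mul_card_filter_definingSet {n : ℕ} {d : Fin n → L} (hd_inj : Function.Injective d)
    {a : F} (ha : a ≠ 0) (hd : Set.range d = definingSet F K a)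
    (hgcd : Nat.gcd (Module.finrank K L) (Fintype.card F - 1) = 1)
    (R : L → Prop) [DecidablePred R] (hR : ∀ c : F, c ≠ 0 → ∀ x, R (c • x) ↔ R x) :
    (Fintype.card F - 1) * (Finset.univ.filter fun i => R (d i)).card
      = (Finset.univ.filter fun x : L =>
          Algebra.trace F K (Algebra.norm K x) ≠ 0 ∧ R x).card := by
  classical
  have hfib : ∀ s : F, s ≠ 0 → (Finset.univ.filter fun x : L =>
      Algebra.trace F K (Algebra.norm K x) = s ∧ R x).card
        = (Finset.univ.filter fun i => R (d i)).card := by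
    intro s hs
    obtain ⟨c, hc, hcs⟩ := exists_pow_eq_of_coprime hgcd (div_ne_zero hs (neg_ne_zero.mpr ha))
    symm
    refine Finset.card_bij (fun i _ => c • d i) ?_ ?_ ?_
    · intro i hi
      have hdi := (mem_definingSet_iff ha).mp (hd ▸ Set.mem_range_self i : d i ∈ definingSet F K a)
      rw [Finset.mem_filter] at hi ⊢
      refine ⟨Finset.mem_univ _, ?_, (hR c hc _).mpr hi.2⟩
      rw [trace_norm_smul, hdi, hcs, div_mul_cancel₀ _ (neg_ne_zero.mpr ha)]
    · intro i _ j _ h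
      exact hd_inj (smul_right_injective L hc h)
    · intro x hx
      rw [Finset.mem_filter] at hx
      have hx' : c⁻¹ • x ∈ Set.range d := by
        rw [hd, mem_definingSet_iff ha, trace_norm_smul, hx.2.1, inv_pow, hcs]
        field_simp
      obtain ⟨i, hi⟩ := hx'
      have hcx : c • d i = x := by rw [hi, smul_inv_smul₀ hc]
      exact ⟨i, Finset.mem_filter.mpr ⟨Finset.mem_univ _, by rw [← hR c hc, hcx]; exact hx.2.2⟩,
        hcx⟩
  have hmaps : ∀ x ∈ Finset.univ.filter (fun x : L =>
      Algebra.trace F K (Algebra.norm K x) ≠ 0 ∧ R x),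
      Algebra.trace F K (Algebra.norm K x) ∈ (Finset.univ : Finset F).erase 0 := by
    intro x hx
    rw [Finset.mem_filter] at hx
    exact Finset.mem_erase.mpr ⟨hx.2.1, Finset.mem_univ _⟩
  rw [Finset.card_eq_sum_card_fiberwise hmaps,
    Finset.sum_congr rfl (g := fun _ => (Finset.univ.filter fun i => R (d i)).card),
    Finset.sum_const, Finset.card_erase_of_mem (Finset.mem_univ _), Finset.card_univ, smul_eq_mul]
  intro s hs
  rw [← hfib s (Finset.ne_of_mem_erase hs), Finset.filter_filter]
  congr 1
  ext x
  simp only [Finset.mem_filter, Finset.mem_univ, true_and]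
  have := Finset.ne_of_mem_erase hs
  constructor
  · rintro ⟨⟨-, h⟩, h'⟩; exact ⟨h', h⟩
  · rintro ⟨h, h'⟩; exact ⟨⟨h ▸ this, h'⟩, h⟩

variable {n : ℕ} {d : Fin n → L} (hd_inj : Function.Injective d) {a : F} (ha : a ≠ 0)
  (hd : Set.range d = definingSet F K a)
  (hgcd : Nat.gcd (Module.finrank K L) (Fintype.card F - 1) = 1)

include hd_inj ha hd hgcd

/-- The length of the code, from the number of `x` whose norm has nonzero trace. -/
theorem length_mul :
    n * (Fintype.card F * (Fintype.card K - 1)) = Fintype.card K * (Fintype.card L - 1) := by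
  obtain ⟨ψ, hψ, -⟩ := exists_canonicalAddChar_eq F K
  have h1 := card_mul_card_filter_definingSet hd_inj ha hd hgcd (fun _ => True) (by simp)
  have h2 := card_trace_norm_ne_zero K L hψ
  simp only [Finset.filter_true, and_true, Finset.card_univ, Fintype.card_fin] at h1
  rw [← h1] at h2
  have hq : Fintype.card F - 1 ≠ 0 := (Nat.sub_pos_of_lt Fintype.one_lt_card).ne'
  apply mul_left_cancel₀ hq
  have hF : ((Fintype.card F - 1 : ℕ) : ℂ) = (Fintype.card F : ℂ) - 1 := by
    rw [Nat.cast_sub Fintype.card_pos, Nat.cast_one]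
  have hK : ((Fintype.card K - 1 : ℕ) : ℂ) = (Fintype.card K : ℂ) - 1 := by
    rw [Nat.cast_sub Fintype.card_pos, Nat.cast_one]
  have hL : ((Fintype.card L - 1 : ℕ) : ℂ) = (Fintype.card L : ℂ) - 1 := by
    rw [Nat.cast_sub Fintype.card_pos, Nat.cast_one]
  have : (((Fintype.card F - 1) * (n * (Fintype.card F * (Fintype.card K - 1))) : ℕ) : ℂ)
      = (((Fintype.card F - 1) * (Fintype.card K * (Fintype.card L - 1)) : ℕ) : ℂ) := by
    push_cast [hF, hK, hL] at h2 ⊢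
    linear_combination h2
  exact_mod_cast this

/-- The weight of `c_b` as an exponential sum. -/
theorem card_mul_weight_eq {ψ : AddChar F ℂ} (hψ : ψ ≠ 1) (b : L) :
    (Fintype.card F : ℂ) * hammingNorm (codeword F d b)
      = (Finset.univ.filter fun x : L => Algebra.trace F K (Algebra.norm K x) ≠ 0).card
        - ∑ x : L with Algebra.trace F K (Algebra.norm K x) ≠ 0,
            ψ (Algebra.trace F L (b * x)) := by
  have h1 := card_mul_card_filter_definingSet hd_inj ha hd hgcd
    (fun x => Algebra.trace F L (b * x) ≠ 0) (by
      intro c hc x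
      rw [mul_smul_comm, map_smul, smul_eq_mul, mul_ne_zero_iff_left hc])
  have hw : (Finset.univ.filter fun i => Algebra.trace F L (b * d i) ≠ 0).card
      = hammingNorm (codeword F d b) := rfl
  rw [hw] at h1
  set E := Finset.univ.filter fun x : L => Algebra.trace F K (Algebra.norm K x) ≠ 0 with hE
  set S := ∑ x ∈ E, ψ (Algebra.trace F L (b * x)) with hS
  have hF0 : Fintype.card F - 1 ≠ 0 := (Nat.sub_pos_of_lt Fintype.one_lt_card).ne'
  have hF : ((Fintype.card F - 1 : ℕ) : ℂ) = (Fintype.card F : ℂ) - 1 := by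
    rw [Nat.cast_sub Fintype.card_pos, Nat.cast_one]
  have h2 : ∀ t : F, t ≠ 0 → ∑ x ∈ E, ψ (t * Algebra.trace F L (b * x)) = S := by
    intro t ht
    have hmem : ∀ c : F, c ≠ 0 → ∀ x ∈ E, c • x ∈ E := by
      intro c hc x hx
      rw [hE, Finset.mem_filter] at hx ⊢
      exact ⟨Finset.mem_univ _, by rw [trace_norm_smul]; exact mul_ne_zero (pow_ne_zero _ hc) hx.2⟩
    refine Finset.sum_bij' (fun x _ => t • x) (fun x _ => t⁻¹ • x) (hmem t ht)
      (hmem _ (inv_ne_zero ht)) ?_ ?_ ?_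
    · intro x _; exact inv_smul_smul₀ ht x
    · intro x _; exact smul_inv_smul₀ ht x
    · intro x _; rw [mul_smul_comm, map_smul, smul_eq_mul]
  have h3 : ∑ t : F, ∑ x ∈ E, ψ (t * Algebra.trace F L (b * x))
      = E.card + ((Fintype.card F : ℂ) - 1) * S := by
    rw [← Finset.add_sum_erase _ _ (Finset.mem_univ (0 : F)), Finset.sum_congr (g := fun _ => S) rfl
      fun t ht => h2 t (Finset.ne_of_mem_erase ht), Finset.sum_const,
      Finset.card_erase_of_mem (Finset.mem_univ _), Finset.card_univ, nsmul_eq_mul, hF]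
    simp
  have h4 : ∑ t : F, ∑ x ∈ E, ψ (t * Algebra.trace F L (b * x))
      = Fintype.card F * (E.filter fun x => Algebra.trace F L (b * x) = 0).card := by
    rw [Finset.sum_comm, Finset.sum_congr rfl fun x _ => sum_addChar_mul hψ _, ← Finset.sum_filter,
      Finset.sum_const, nsmul_eq_mul, mul_comm]
  have h5 := Finset.card_filter_add_card_filter_not (s := E)
    (fun x => Algebra.trace F L (b * x) = 0)
  have h6 : (E.filter fun x => ¬ Algebra.trace F L (b * x) = 0)
      = Finset.univ.filter fun x : L => Algebra.trace F K (Algebra.norm K x) ≠ 0 ∧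
        Algebra.trace F L (b * x) ≠ 0 := by
    rw [hE, Finset.filter_filter]
  rw [h6, ← h1] at h5
  have h7 : ((E.filter fun x => Algebra.trace F L (b * x) = 0).card : ℂ)
      + ((Fintype.card F : ℂ) - 1) * hammingNorm (codeword F d b) = E.card := by
    rw [← h5]; push_cast [hF]; ring
  rw [h3] at h4
  have hF0' : (Fintype.card F : ℂ) - 1 ≠ 0 := by rw [← hF]; exact_mod_cast hF0
  apply mul_left_cancel₀ hF0'
  linear_combination (Fintype.card F : ℂ) * h7 + h4

/-- The Hamming weight of `c_b` in terms of Gauss sums over the intermediate field. -/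
theorem weight_eq [DecidableEq (MulChar K ℂ)] {ψ : AddChar F ℂ} (hψ : ψ ≠ 1) {b : L}
    (hb : b ≠ 0) :
    (Fintype.card F : ℂ) ^ 2 * ((Fintype.card K : ℂ) - 1) * hammingNorm (codeword F d b)
      = ((Fintype.card F : ℂ) - 1) * Fintype.card K * (Fintype.card L
        + (-1) ^ (Module.finrank K L - 1) * ∑ θ ∈ (trivialOnBase F K).erase 1, θ (-1)
          * gaussSum θ (traceChar K ψ) ^ (Module.finrank K L - 1) * θ⁻¹ (Algebra.norm K b)) := by
  have h1 := card_mul_weight_eq hd_inj ha hd hgcd hψ b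
  have h2 := card_trace_norm_ne_zero K L hψ
  have h3 := expSum_trace_norm_ne_zero K L hψ hb
  linear_combination (Fintype.card F : ℂ) * ((Fintype.card K : ℂ) - 1) * h1 + h2 - h3

/-- The lower bound on the weights that comes from `|G(θ)| = √|K|`. -/
theorem weight_ge {b : L} (hb : b ≠ 0) :
    ((Fintype.card F : ℝ) - 1) * Fintype.card K * (Fintype.card L
        - ((trivialOnBase F K).card - 1) * √(Fintype.card K) ^ (Module.finrank K L - 1))
      ≤ (Fintype.card F : ℝ) ^ 2 * ((Fintype.card K : ℝ) - 1) * hammingNorm (codeword F d b) := by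
  classical
  obtain ⟨ψ, hψ, -⟩ := exists_canonicalAddChar_eq F K
  have h1 := weight_eq hd_inj ha hd hgcd hψ hb
  have h2 := norm_sum_trivialOnBase_le hψ (Module.finrank K L - 1) (Algebra.norm K b)
  set S := ∑ θ ∈ (trivialOnBase F K).erase 1, θ (-1)
    * gaussSum θ (traceChar K ψ) ^ (Module.finrank K L - 1) * θ⁻¹ (Algebra.norm K b)
  have h3 : (Fintype.card F : ℝ) ^ 2 * ((Fintype.card K : ℝ) - 1) * hammingNorm (codeword F d b)
      = ((Fintype.card F : ℝ) - 1) * Fintype.card K * (Fintype.card L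
        + ((-1 : ℂ) ^ (Module.finrank K L - 1) * S).re) := by
    have h := congrArg Complex.re (a₁ := (((Fintype.card F : ℝ) ^ 2 * ((Fintype.card K : ℝ) - 1)
      * hammingNorm (codeword F d b) : ℝ) : ℂ))
      (a₂ := ((((Fintype.card F : ℝ) - 1) * Fintype.card K : ℝ) : ℂ) * (((Fintype.card L : ℝ) : ℂ)
        + (-1 : ℂ) ^ (Module.finrank K L - 1) * S)) (by push_cast; exact h1)
    rwa [Complex.re_ofReal_mul, Complex.add_re, Complex.ofReal_re, Complex.ofReal_re] at h
  have h4 : -‖S‖ ≤ ((-1 : ℂ) ^ (Module.finrank K L - 1) * S).re := by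
    have := (abs_le.mp (Complex.abs_re_le_norm ((-1 : ℂ) ^ (Module.finrank K L - 1) * S))).1
    simpa using this
  rw [h3]
  have hF : (0 : ℝ) ≤ (Fintype.card F : ℝ) - 1 := by
    rw [sub_nonneg]; exact_mod_cast Fintype.card_pos
  gcongr
  linarith

/-- The lower bound `weight_ge` is positive, as `√|K| ^ (m - 1) ≤ |K| ^ (m - 1)` and fewer than
`|K|` characters contribute. -/
theorem weight_pos {b : L} (hb : b ≠ 0) : 0 < hammingNorm (codeword F d b) := by
  have h := weight_ge hd_inj ha hd hgcd hb
  have hT := card_trivialOnBase_mul F K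
  have hF := Fintype.one_lt_card (α := F)
  have hK := Fintype.one_lt_card (α := K)
  obtain ⟨m, hm⟩ := Nat.exists_eq_add_one.mpr (Module.finrank_pos (R := K) (M := L))
  have hL : (Fintype.card L : ℝ) = (Fintype.card K : ℝ) ^ (m + 1) := by
    rw [← hm, Module.card_eq_pow_finrank (K := K) (V := L)]; push_cast; rfl
  rw [hm, hL, Nat.add_sub_cancel] at h
  have hTle : ((trivialOnBase F K).card : ℝ) ≤ Fintype.card K := by
    have : (trivialOnBase F K).card ≤ Fintype.card K := by
      have : (trivialOnBase F K).card * 1 ≤ (trivialOnBase F K).card * (Fintype.card F - 1) :=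
        Nat.mul_le_mul_left _ (by omega)
      omega
    exact_mod_cast this
  have hK' : (1 : ℝ) < Fintype.card K := by exact_mod_cast hK
  have hF' : (1 : ℝ) < Fintype.card F := by exact_mod_cast hF
  have hsq : √(Fintype.card K : ℝ) ≤ Fintype.card K := by
    rw [Real.sqrt_le_left (by linarith)]; nlinarith
  have hpow : √(Fintype.card K : ℝ) ^ m ≤ (Fintype.card K : ℝ) ^ m :=
    pow_le_pow_left₀ (Real.sqrt_nonneg _) hsq m
  have hpos : (0 : ℝ) < (Fintype.card K : ℝ) ^ m := by positivity
  have hlt : ((trivialOnBase F K).card - 1) * √(Fintype.card K : ℝ) ^ m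
      < (Fintype.card K : ℝ) ^ (m + 1) := by
    calc ((trivialOnBase F K).card - 1) * √(Fintype.card K : ℝ) ^ m
        ≤ ((Fintype.card K : ℝ) - 1) * (Fintype.card K : ℝ) ^ m := by
          have : (0 : ℝ) ≤ √(Fintype.card K : ℝ) ^ m := by positivity
          nlinarith
      _ < _ := by rw [pow_succ]; nlinarith
  rcases Nat.eq_zero_or_pos (hammingNorm (codeword F d b)) with h0 | h0
  · rw [h0, Nat.cast_zero, mul_zero] at h
    have : 0 < ((Fintype.card F : ℝ) - 1) * Fintype.card K * ((Fintype.card K : ℝ) ^ (m + 1)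
        - ((trivialOnBase F K).card - 1) * √(Fintype.card K : ℝ) ^ m) := by
      apply mul_pos (mul_pos (by linarith) (by linarith)) (by linarith)
    linarith
  · exact h0

end Weights

/-! ### Parameters of linear codes -/

section CodeParameters

variable {F : Type*} [Field F] [Fintype F] [DecidableEq F]

/-- The Plotkin bound: in a linear code over a field with `q` elements, each coordinate is nonzero
on at most the proportion `1 - 1 / q` of the codewords. -/
theorem IsLinearCode.plotkin {ι : Type*} [Fintype ι] {C : Submodule F (ι → F)} {n l δ : ℕ}
    (hC : IsLinearCode C n (l + 1) δ) : (Fintype.card F ^ (l + 1) - 1) * δ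
      ≤ n * (Fintype.card F ^ (l + 1) - Fintype.card F ^ l) := by
  classical
  obtain ⟨hn, hl, -, hlow⟩ := hC
  have : Fintype C := Fintype.ofFinite C
  have hcard : Fintype.card C = Fintype.card F ^ (l + 1) := by
    rw [Module.card_eq_pow_finrank (K := F), hl]
  have h1 : (Fintype.card F ^ (l + 1) - 1) * δ ≤ ∑ c : C, hammingNorm (c : ι → F) := by
    rw [← hcard, ← Finset.card_univ, ← Finset.card_erase_of_mem (Finset.mem_univ (0 : C)),
      ← smul_eq_mul, ← Finset.sum_const]
    refine (Finset.sum_le_sum fun c hc => ?_).trans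
      (Finset.sum_le_sum_of_subset (Finset.erase_subset (0 : C) Finset.univ))
    refine hlow ⟨c, c.2, 0, C.zero_mem, fun h => Finset.ne_of_mem_erase hc (Subtype.ext h), ?_⟩
    exact hammingDist_zero_right _
  have h2 : ∑ c : C, hammingNorm (c : ι → F)
      = ∑ i : ι, (Finset.univ.filter fun c : C => (c : ι → F) i ≠ 0).card := by
    simp only [hammingNorm, Finset.card_filter]
    exact Finset.sum_comm
  have h3 : ∀ i : ι, (Finset.univ.filter fun c : C => (c : ι → F) i ≠ 0).card
      ≤ Fintype.card F ^ (l + 1) - Fintype.card F ^ l := by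
    intro i
    let g : C →ₗ[F] F := LinearMap.proj i ∘ₗ C.subtype
    have hker : Fintype.card F ^ l ≤ (Finset.univ.filter fun c : C => (c : ι → F) i = 0).card := by
      have hg := g.finrank_range_add_finrank_ker
      have hr : Module.finrank F (LinearMap.range g) ≤ 1 :=
        (Submodule.finrank_le _).trans_eq (Module.finrank_self F)
      have hk : Fintype.card (LinearMap.ker g)
          = (Finset.univ.filter fun c : C => (c : ι → F) i = 0).card := by
        rw [Fintype.card_subtype]; exact congrArg _ (Finset.filter_congr fun c _ => Iff.rfl)
      rw [← hk, Module.card_eq_pow_finrank (K := F) (V := LinearMap.ker g)]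
      exact Nat.pow_le_pow_right Fintype.card_pos (by omega)
    have := Finset.card_filter_add_card_filter_not (s := (Finset.univ : Finset C))
      (fun c : C => (c : ι → F) i = 0)
    rw [Finset.card_univ, hcard] at this
    simp only [← ne_eq] at this
    omega
  calc _ ≤ _ := h1
    _ = _ := h2
    _ ≤ ∑ _i : ι, (Fintype.card F ^ (l + 1) - Fintype.card F ^ l) :=
        Finset.sum_le_sum fun i _ => h3 i
    _ = _ := by rw [Finset.sum_const, Finset.card_univ, hn, smul_eq_mul]

variable {L : Type*} [Field L] [Fintype L] [Algebra F L] {n : ℕ} {d : Fin n → L}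

omit [Fintype F] [Fintype L] in
theorem codeword_injective (hpos : ∀ b : L, b ≠ 0 → 0 < hammingNorm (codeword F d b)) :
    Function.Injective (codeword F d) := by
  rw [injective_iff_map_eq_zero]
  intro b hb
  by_contra h
  have := hpos b h
  rw [hb, hammingNorm_zero] at this
  exact lt_irrefl _ this

omit [Fintype F] [Fintype L] in
theorem isLinearCode_code (hpos : ∀ b : L, b ≠ 0 → 0 < hammingNorm (codeword F d b)) {δ : ℕ}
    (hle : ∀ b : L, b ≠ 0 → δ ≤ hammingNorm (codeword F d b))
    (hex : ∃ b : L, b ≠ 0 ∧ hammingNorm (codeword F d b) = δ) :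
    IsLinearCode (code F d) n (Module.finrank F L) δ := by
  refine ⟨Fintype.card_fin n, ?_, ?_, ?_⟩
  · exact LinearMap.finrank_range_of_inj (codeword_injective hpos)
  · obtain ⟨b, hb, hw⟩ := hex
    refine ⟨codeword F d b, ⟨b, rfl⟩, 0, Submodule.zero_mem _, ?_, by
      rw [hammingDist_zero_right, hw]⟩
    rw [← map_zero (codeword F d)]
    exact (codeword_injective hpos).ne hb
  · rintro m ⟨u, ⟨b, rfl⟩, v, ⟨b', rfl⟩, hne, rfl⟩
    rw [hammingDist_eq_hammingNorm, ← map_neg, ← map_add]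
    refine hle _ fun h => hne ?_
    rw [neg_add_eq_zero.mp h]

omit [Fintype F] in
theorem weightCount_code [DecidableEq L]
    (hpos : ∀ b : L, b ≠ 0 → 0 < hammingNorm (codeword F d b)) {i : ℕ}
    (hi : i ≠ 0) :
    weightCount (code F d) i
      = (Finset.univ.filter fun b : L => b ≠ 0 ∧ hammingNorm (codeword F d b) = i).card := by
  classical
  have h : {c : Fin n → F | c ∈ code F d ∧ hammingNorm c = i} = codeword F d ''
      (Finset.univ.filter fun b : L => b ≠ 0 ∧ hammingNorm (codeword F d b) = i : Finset L) := by
    ext c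
    simp only [Set.mem_ofPred_eq, Set.mem_image, Finset.coe_filter, Finset.mem_univ, true_and]
    constructor
    · rintro ⟨⟨b, rfl⟩, hw⟩
      refine ⟨b, ⟨?_, hw⟩, rfl⟩
      rintro rfl
      rw [map_zero, hammingNorm_zero] at hw
      exact hi hw.symm
    · rintro ⟨b, ⟨-, hw⟩, rfl⟩
      exact ⟨⟨b, rfl⟩, hw⟩
  rw [weightCount, h, Set.ncard_image_of_injective _ (codeword_injective hpos),
    Set.ncard_coe_finset]

omit [Fintype F] in
theorem isWeightCode_one (hpos : ∀ b : L, b ≠ 0 → 0 < hammingNorm (codeword F d b)) {w : ℕ}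
    (hw : ∀ b : L, b ≠ 0 → hammingNorm (codeword F d b) = w) : IsWeightCode (code F d) 1 := by
  classical
  have hw0 : 0 < w := by rw [← hw 1 one_ne_zero]; exact hpos 1 one_ne_zero
  have hwn : w ≤ n := by
    rw [← hw 1 one_ne_zero]
    exact hammingNorm_le_card_fintype.trans_eq (Fintype.card_fin n)
  rw [IsWeightCode, Finset.card_eq_one]
  refine ⟨w, ?_⟩
  ext i
  rw [Finset.mem_filter, Finset.mem_Icc, Finset.mem_singleton, Fintype.card_fin]
  constructor
  · rintro ⟨⟨h1, -⟩, h2⟩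
    rw [weightCount_code hpos (by omega), Finset.card_ne_zero] at h2
    obtain ⟨b, hb⟩ := h2
    rw [Finset.mem_filter] at hb
    rw [← hb.2.2, hw b hb.2.1]
  · rintro rfl
    refine ⟨⟨hw0, hwn⟩, ?_⟩
    rw [weightCount_code hpos hw0.ne', Finset.card_ne_zero]
    exact ⟨1, Finset.mem_filter.mpr ⟨Finset.mem_univ _, one_ne_zero, hw 1 one_ne_zero⟩⟩

omit [Fintype F] in
/-- The weight distribution of a code `{c_b}` whose codewords have weight `w₁` when `b` satisfies
`P` and weight `w₂` otherwise. -/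
theorem twoWeight_code [DecidableEq L]
    (hpos : ∀ b : L, b ≠ 0 → 0 < hammingNorm (codeword F d b)) {w₁ w₂ : ℕ}
    (hne : w₁ ≠ w₂) (P : L → Prop) [DecidablePred P]
    (h₁ : ∀ b : L, b ≠ 0 → P b → hammingNorm (codeword F d b) = w₁)
    (h₂ : ∀ b : L, b ≠ 0 → ¬ P b → hammingNorm (codeword F d b) = w₂)
    {N₁ N₂ : ℕ} (hN₁ : (Finset.univ.filter fun b : L => b ≠ 0 ∧ P b).card = N₁)
    (hN₂ : (Finset.univ.filter fun b : L => b ≠ 0 ∧ ¬ P b).card = N₂)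
    (hN₁0 : 0 < N₁) (hN₂0 : 0 < N₂) :
    IsWeightCode (code F d) 2 ∧
      weightEnumerator (code F d) = 1 + N₁ • X ^ w₁ + N₂ • X ^ w₂ := by
  obtain ⟨b₁, hb₁⟩ := Finset.card_pos.mp (hN₁ ▸ hN₁0)
  obtain ⟨b₂, hb₂⟩ := Finset.card_pos.mp (hN₂ ▸ hN₂0)
  rw [Finset.mem_filter] at hb₁ hb₂
  have e₁ := h₁ b₁ hb₁.2.1 hb₁.2.2
  have e₂ := h₂ b₂ hb₂.2.1 hb₂.2.2
  have hw₁ : 0 < w₁ := by rw [← e₁]; exact hpos _ hb₁.2.1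
  have hw₂ : 0 < w₂ := by rw [← e₂]; exact hpos _ hb₂.2.1
  have hw₁n : w₁ ≤ n := by
    rw [← e₁]; exact hammingNorm_le_card_fintype.trans_eq (Fintype.card_fin n)
  have hw₂n : w₂ ≤ n := by
    rw [← e₂]; exact hammingNorm_le_card_fintype.trans_eq (Fintype.card_fin n)
  have c₁ : weightCount (code F d) w₁ = N₁ := by
    rw [weightCount_code hpos hw₁.ne', ← hN₁]
    congr 1
    refine Finset.filter_congr fun b _ => and_congr_right fun hb => ?_
    refine ⟨fun h => ?_, h₁ b hb⟩
    by_contra hP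
    exact hne (h.symm.trans (h₂ b hb hP))
  have c₂ : weightCount (code F d) w₂ = N₂ := by
    rw [weightCount_code hpos hw₂.ne', ← hN₂]
    congr 1
    refine Finset.filter_congr fun b _ => and_congr_right fun hb => ?_
    refine ⟨fun h hP => ?_, h₂ b hb⟩
    exact hne ((h₁ b hb hP).symm.trans h)
  have c₃ : ∀ i ∈ Finset.Icc 1 n, i ∉ ({w₁, w₂} : Finset ℕ) → weightCount (code F d) i = 0 := by
    intro i hi hiw
    rw [Finset.mem_Icc] at hi
    rw [weightCount_code hpos (by omega), Finset.card_eq_zero, Finset.filter_eq_empty_iff]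
    rintro b - ⟨hb, rfl⟩
    rw [Finset.mem_insert, Finset.mem_singleton] at hiw
    by_cases hP : P b
    · exact hiw (Or.inl (h₁ b hb hP))
    · exact hiw (Or.inr (h₂ b hb hP))
  have hsub : ({w₁, w₂} : Finset ℕ) ⊆ Finset.Icc 1 n := by
    intro i hi
    rw [Finset.mem_insert, Finset.mem_singleton] at hi
    rw [Finset.mem_Icc]
    omega
  constructor
  · rw [IsWeightCode, Fintype.card_fin, ← Finset.card_pair hne]
    congr 1
    ext i
    rw [Finset.mem_filter]
    constructor
    · rintro ⟨hi, hc⟩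
      by_contra hiw
      exact hc (c₃ i hi hiw)
    · intro hi
      refine ⟨hsub hi, ?_⟩
      rw [Finset.mem_insert, Finset.mem_singleton] at hi
      rcases hi with rfl | rfl
      · rw [c₁]; exact hN₁0.ne'
      · rw [c₂]; exact hN₂0.ne'
  · rw [weightEnumerator, Fintype.card_fin, ← Finset.sum_subset hsub fun i hi hiw => by
      rw [c₃ i hi hiw, zero_smul], Finset.sum_pair hne, c₁, c₂, add_assoc]

end CodeParameters

/-! ### Weights for a quadratic intermediate extension -/

section Quadratic

variable {F K L : Type*} [Field F] [Fintype F] [DecidableEq F] [Field K] [Fintype K] [Field L]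
  [Fintype L] [Algebra F K] [Algebra K L] [Algebra F L] [IsScalarTower F K L]

/-- The weights in the case of a quadratic extension `K` of `F`: the two cases are separated by the
coset of `Fˣ` in which the norm of `b` lies. -/
theorem exists_weight_quadratic [DecidableEq L] {n : ℕ} {d : Fin n → L}
    (hd_inj : Function.Injective d) {a : F}
    (ha : a ≠ 0) (hd : Set.range d = definingSet F K a) {m : ℕ}
    (hm : Module.finrank K L = m + 1)
    (hgcd : Nat.gcd (Module.finrank K L) (Fintype.card F - 1) = 1)
    (hf : Module.finrank F K = 2) :
    ∃ P : L → Prop, ∃ _ : DecidablePred P,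
      (Fintype.card F + 1) * (Finset.univ.filter fun b : L => b ≠ 0 ∧ P b).card
        = Fintype.card L - 1 ∧
      (∀ b : L, b ≠ 0 → P b → ((Fintype.card F : ℤ) + 1) * hammingNorm (codeword F d b)
        = Fintype.card L + (-1) ^ m * (Fintype.card F : ℤ) ^ (m + 1)) ∧
      (∀ b : L, b ≠ 0 → ¬ P b → ((Fintype.card F : ℤ) + 1) * hammingNorm (codeword F d b)
        = Fintype.card L - (-1) ^ m * (Fintype.card F : ℤ) ^ m) := by
  classical
  obtain ⟨ψ, hψ, -⟩ := exists_canonicalAddChar_eq F K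
  have hcK : Fintype.card K = Fintype.card F ^ 2 := by
    rw [Module.card_eq_pow_finrank (K := F) (V := K), hf]
  have hq := Fintype.one_lt_card (α := F)
  set q := Fintype.card F with hqdef
  have hT : (trivialOnBase F K).card = q + 1 := by
    have h := card_trivialOnBase_mul F K
    rw [hcK] at h
    refine Nat.eq_of_mul_eq_mul_right (Nat.sub_pos_of_lt hq) (h.trans ?_)
    rw [← Nat.sq_sub_sq, one_pow]
  obtain ⟨y₀, htr, hy₀⟩ : ∃ y₀ : K, Algebra.trace F K y₀ = 0 ∧ y₀ ≠ 0 := by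
    have h1 := (Algebra.trace F K).finrank_range_add_finrank_ker
    rw [LinearMap.range_eq_top.mpr (Algebra.trace_surjective F K), finrank_top,
      Module.finrank_self, hf] at h1
    have h2 : Nontrivial (LinearMap.ker (Algebra.trace F K)) :=
      Module.nontrivial_of_finrank_pos (R := F) (by omega)
    obtain ⟨y, hy⟩ := exists_ne (0 : LinearMap.ker (Algebra.trace F K))
    exact ⟨y, y.2, fun h => hy (Subtype.ext h)⟩
  let v : L → K := fun b => y₀ ^ m * (Algebra.norm K b)⁻¹
  have hNb : ∀ b : L, b ≠ 0 → Algebra.norm K b ≠ 0 := fun b hb => Algebra.norm_ne_zero_iff.mpr hb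
  have hsum : ∀ b : L, b ≠ 0 → ∑ θ ∈ trivialOnBase F K, θ (v b)
      = if v b ∈ Set.range (algebraMap F K) then (q : ℂ) + 1 else 0 := by
    intro b hb
    split_ifs with h
    · obtain ⟨c, hc⟩ := h
      have hv : v b ≠ 0 := mul_ne_zero (pow_ne_zero _ hy₀) (inv_ne_zero (hNb b hb))
      have hc0 : c ≠ 0 := by
        rintro rfl
        exact hv (by rw [← hc, map_zero])
      rw [← hc, Finset.sum_congr rfl fun θ hθ => mem_trivialOnBase.mp hθ c hc0, Finset.sum_const,
        hT]
      simp
    · exact sum_trivialOnBase_apply_eq_zero F h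
  refine ⟨fun b => v b ∈ Set.range (algebraMap F K), inferInstance, ?_, ?_⟩
  · have h1 : ∑ b : L, ∑ θ ∈ trivialOnBase F K, θ (v b) = (Fintype.card L : ℂ) - 1 := by
      rw [Finset.sum_comm, Finset.sum_eq_single (1 : MulChar K ℂ)]
      · rw [← sum_one_mulChar]
        refine Finset.sum_congr rfl fun b _ => ?_
        by_cases hb : b = 0
        · simp [v, hb, Algebra.norm_zero, MulChar.map_zero]
        · rw [MulChar.one_apply (Ne.isUnit hb), MulChar.one_apply]
          exact (mul_ne_zero (pow_ne_zero _ hy₀) (inv_ne_zero (hNb b hb))).isUnit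
      · intro θ _ hθ
        simp only [v, map_mul, ← MulChar.inv_apply']
        rw [← Finset.mul_sum, sum_norm K L _ (inv_ne_one.mpr hθ), mul_zero]
      · intro h
        exact absurd (one_mem_trivialOnBase F K) h
    have h2 : ∑ b : L, ∑ θ ∈ trivialOnBase F K, θ (v b) = ((q : ℂ) + 1)
        * (Finset.univ.filter fun b : L => b ≠ 0 ∧ v b ∈ Set.range (algebraMap F K)).card := by
      rw [← Finset.filter_filter, Finset.card_filter, Finset.filter_ne',
        ← Finset.add_sum_erase _ _ (Finset.mem_univ (0 : L)), Finset.sum_eq_zero, zero_add,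
        Finset.sum_congr rfl fun b hb => hsum b (Finset.ne_of_mem_erase hb)]
      · push_cast
        rw [Finset.mul_sum]
        exact Finset.sum_congr rfl fun b _ => by split_ifs <;> simp
      · intro θ _
        simp [v, Algebra.norm_zero, MulChar.map_zero]
    have h3 : (((q + 1) * (Finset.univ.filter fun b : L => b ≠ 0 ∧
        v b ∈ Set.range (algebraMap F K)).card : ℕ) : ℂ) = ((Fintype.card L - 1 : ℕ) : ℂ) := by
      rw [Nat.cast_sub Fintype.card_pos]
      push_cast
      rw [← h2, h1]
    exact_mod_cast h3
  · have key : ∀ b : L, b ≠ 0 → ((q : ℂ) + 1) * hammingNorm (codeword F d b)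
        = Fintype.card L + (-1) ^ m * ((q : ℂ) ^ m * (∑ θ ∈ trivialOnBase F K, θ (v b) - 1)) := by
      intro b hb
      have h := weight_eq hd_inj ha hd hgcd hψ hb
      rw [hm, Nat.add_sub_cancel] at h
      have hterm : ∀ θ ∈ (trivialOnBase F K).erase 1, θ (-1) * gaussSum θ (traceChar K ψ) ^ m
          * θ⁻¹ (Algebra.norm K b) = (q : ℂ) ^ m * θ (v b) := by
        intro θ hθ
        rw [Finset.mem_erase] at hθ
        have h1 : θ (-1) = 1 := by
          have := mem_trivialOnBase.mp hθ.2 (-1) (neg_ne_zero.mpr one_ne_zero)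
          rwa [map_neg, map_one] at this
        rw [h1, gaussSum_of_finrank_eq_two hψ hf hy₀ htr hθ.1 hθ.2, mul_pow, one_mul,
          MulChar.inv_apply', map_mul, map_pow, mul_assoc]
      have hone : (1 : MulChar K ℂ) (v b) = 1 := MulChar.one_apply
        (mul_ne_zero (pow_ne_zero _ hy₀) (inv_ne_zero (hNb b hb))).isUnit
      rw [Finset.sum_congr rfl hterm, ← Finset.mul_sum,
        Finset.sum_erase_eq_sub (one_mem_trivialOnBase F K), hone, hcK] at h
      have hq0 : (q : ℂ) ^ 2 * ((q : ℂ) - 1) ≠ 0 := by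
        refine mul_ne_zero (pow_ne_zero _ ?_) (sub_ne_zero.mpr ?_)
        · exact_mod_cast (by omega : q ≠ 0)
        · exact_mod_cast hq.ne'
      apply mul_left_cancel₀ hq0
      push_cast at h
      linear_combination h
    constructor
    · intro b hb hP
      have h := key b hb
      rw [hsum b hb, if_pos hP] at h
      have h' : ((q : ℂ) + 1) * hammingNorm (codeword F d b)
          = Fintype.card L + (-1) ^ m * (q : ℂ) ^ (m + 1) := by rw [h]; ring
      exact_mod_cast h'
    · intro b hb hP
      have h := key b hb
      rw [hsum b hb, if_neg hP] at h
      have h' : ((q : ℂ) + 1) * hammingNorm (codeword F d b)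
          = Fintype.card L - (-1) ^ m * (q : ℂ) ^ m := by rw [h]; ring
      exact_mod_cast h'

end Quadratic

/-! ### Parameters of the code of the defining set -/

section Parameters

variable {F K L : Type*} [Field F] [Fintype F] [DecidableEq F] [Field K] [Fintype K] [Field L]
  [Fintype L] [Algebra F K] [Algebra K L] [Algebra F L] [IsScalarTower F K L]
  {n : ℕ} {d : Fin n → L} (hd_inj : Function.Injective d) {a : F} (ha : a ≠ 0)
  (hd : Set.range d = definingSet F K a)
  (hgcd : Nat.gcd (Module.finrank K L) (Fintype.card F - 1) = 1)
  {q f k : ℕ} (hq : Fintype.card F = q) (hf : Module.finrank F K = f)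
  (hk : Module.finrank F L = k)

omit [DecidableEq F] [Fintype L] [IsScalarTower F K L] [Algebra K L] [Algebra F L] in
include hq hf in
theorem card_middle : Fintype.card K = q ^ f := by
  rw [Module.card_eq_pow_finrank (K := F) (V := K), hq, hf]

include hd_inj ha hd hgcd hq hf hk

theorem length_eq : n = q ^ (f - 1) * (q ^ k - 1) / (q ^ f - 1) := by
  have h := length_mul hd_inj ha hd hgcd
  have hf0 : 0 < f := hf ▸ Module.finrank_pos
  obtain ⟨e, rfl⟩ := Nat.exists_eq_add_one.mpr hf0
  have hq1 : 1 < q := hq ▸ Fintype.one_lt_card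
  rw [card_middle hq hf, card_middle hq hk, hq] at h
  have h1 : 1 < q ^ (e + 1) := Nat.one_lt_pow (by omega) hq1
  rw [Nat.add_sub_cancel]
  refine (Nat.div_eq_of_eq_mul_left (by omega) ?_).symm
  apply Nat.eq_of_mul_eq_mul_left (by omega : 0 < q)
  rw [← mul_assoc, ← pow_succ', ← h]
  ring

theorem weight_eq_of_finrank_eq_one (hf1 : f = 1) {b : L} (hb : b ≠ 0) :
    hammingNorm (codeword F d b) = q ^ (k - 1) := by
  classical
  obtain ⟨ψ, hψ, -⟩ := exists_canonicalAddChar_eq F K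
  have hq1 : 1 < q := hq ▸ Fintype.one_lt_card
  have hk0 : 0 < k := hk ▸ Module.finrank_pos
  obtain ⟨e, rfl⟩ := Nat.exists_eq_add_one.mpr hk0
  have hK := card_middle (F := F) (K := K) hq hf
  rw [hf1, pow_one] at hK
  have hT : (trivialOnBase F K).card = 1 := by
    have h := card_trivialOnBase_mul F K
    rw [hK, hq] at h
    exact Nat.eq_of_mul_eq_mul_right (by omega : 0 < q - 1) (h.trans (one_mul _).symm)
  have hempty : (trivialOnBase F K).erase 1 = ∅ := by
    rw [← Finset.card_eq_zero, Finset.card_erase_of_mem (one_mem_trivialOnBase F K), hT]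
  have h := weight_eq hd_inj ha hd hgcd hψ hb
  rw [hempty, Finset.sum_empty, mul_zero, add_zero, hK, hq,
    card_middle (F := F) (K := L) hq hk] at h
  have hne : (q : ℂ) ^ 2 * ((q : ℂ) - 1) ≠ 0 := by
    refine mul_ne_zero (pow_ne_zero _ ?_) (sub_ne_zero.mpr ?_)
    · exact_mod_cast (by omega : q ≠ 0)
    · exact_mod_cast hq1.ne'
  have h2 : (hammingNorm (codeword F d b) : ℂ) = (q : ℂ) ^ e := by
    apply mul_left_cancel₀ hne
    push_cast at h
    linear_combination h
  rw [Nat.add_sub_cancel]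
  exact_mod_cast h2

/-- With `K = F` every nonzero codeword has weight `q ^ (k - 1)`: the code is a simplex code. -/
theorem oneWeight_code (hf1 : f = 1) :
    IsOptimalCode (code F d) ((q ^ k - 1) / (q - 1)) k (q ^ (k - 1)) ∧
    AchievesGriesmer (code F d) ((q ^ k - 1) / (q - 1)) k (q ^ (k - 1)) ∧
    IsWeightCode (code F d) 1 := by
  have hq1 : 1 < q := hq ▸ Fintype.one_lt_card
  have hk0 : 0 < k := hk ▸ Module.finrank_pos
  have hpos : ∀ b : L, b ≠ 0 → 0 < hammingNorm (codeword F d b) :=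
    fun b hb => weight_pos hd_inj ha hd hgcd hb
  have hw : ∀ b : L, b ≠ 0 → hammingNorm (codeword F d b) = q ^ (k - 1) :=
    fun b hb => weight_eq_of_finrank_eq_one hd_inj ha hd hgcd hq hf hk hf1 hb
  have hn : n = (q ^ k - 1) / (q - 1) := by
    have := length_eq hd_inj ha hd hgcd hq hf hk
    rwa [hf1, Nat.sub_self, pow_zero, one_mul, pow_one] at this
  have hcode : IsLinearCode (code F d) ((q ^ k - 1) / (q - 1)) k (q ^ (k - 1)) := by
    rw [← hn, ← hk]
    refine isLinearCode_code hpos (fun b hb => ?_) ⟨1, one_ne_zero, ?_⟩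
    · rw [hk]; exact (hw b hb).ge
    · rw [hk]; exact hw 1 one_ne_zero
  have hgeom : ∑ i ∈ Finset.range k, q ^ i = (q ^ k - 1) / (q - 1) := Nat.geomSum_eq hq1 k
  refine ⟨⟨hcode, ?_⟩, ⟨hcode, ?_⟩, isWeightCode_one hpos hw⟩
  · rintro ⟨C', hC'⟩
    obtain ⟨e, rfl⟩ := Nat.exists_eq_add_one.mpr hk0
    -- the bound reads `(q ^ k - 1) * (q ^ (k - 1) + 1) ≤ (q ^ k - 1) * q ^ (k - 1)`
    have h := hC'.plotkin
    have hdvd : (q ^ (e + 1) - 1) / (q - 1) * (q - 1) = q ^ (e + 1) - 1 :=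
      Nat.div_mul_cancel (by simpa using Nat.sub_dvd_pow_sub_pow q 1 (e + 1))
    have hsplit : q ^ (e + 1) - q ^ e = (q - 1) * q ^ e := by
      rw [Nat.sub_mul, one_mul, pow_succ']
    rw [hq, hsplit, ← mul_assoc, hdvd, Nat.add_sub_cancel] at h
    have h1 : 1 < q ^ (e + 1) := Nat.one_lt_pow (by omega) hq1
    have := Nat.le_of_mul_le_mul_left h (by omega)
    omega
  · rw [← hgeom, ← Finset.sum_range_reflect, hq]
    refine Finset.sum_congr rfl fun i hi => ?_
    rw [Finset.mem_range] at hi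
    have hq0 : (q : ℚ) ≠ 0 := by exact_mod_cast (by omega : q ≠ 0)
    have : ((q ^ (k - 1) : ℕ) : ℚ) / (q : ℚ) ^ i = ((q ^ (k - 1 - i) : ℕ) : ℚ) := by
      push_cast
      rw [div_eq_iff (pow_ne_zero _ hq0), ← pow_add]
      congr 1
      omega
    rw [this, Nat.ceil_natCast]

/-- `weight_ge` in terms of `q`, `f` and `k`, using
`q ^ f * √(q ^ f) ^ (k / f - 1) = q ^ ((k + f) / 2)`. -/
theorem weight_lower_bound (hf1 : 1 < f) {b : L} (hb : b ≠ 0) :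
    (((q : ℝ) - 1) * (q : ℝ) ^ (f + k - 2)
      - ((q : ℝ) ^ f - q) * (q : ℝ) ^ (((k : ℝ) + f) / 2 - 2)) / ((q : ℝ) ^ f - 1)
      ≤ (hammingNorm (codeword F d b) : ℝ) := by
  have h := weight_ge hd_inj ha hd hgcd hb
  have hq1 : 1 < q := hq ▸ Fintype.one_lt_card
  have hqR : (1 : ℝ) < q := by exact_mod_cast hq1
  have hq0 : (0 : ℝ) < q := by linarith
  obtain ⟨m, hm⟩ := Nat.exists_eq_add_one.mpr (Module.finrank_pos (R := K) (M := L))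
  have hkfm : k = f * (m + 1) := by
    rw [← hk, ← hf, ← hm, Module.finrank_mul_finrank]
  have hT : (((trivialOnBase F K).card : ℝ) - 1) * ((q : ℝ) - 1) = (q : ℝ) ^ f - q := by
    have h1 := card_trivialOnBase_mul F K
    rw [card_middle hq hf, hq] at h1
    have h2 : ((trivialOnBase F K).card : ℝ) * ((q : ℝ) - 1) = (q : ℝ) ^ f - 1 := by
      have := congrArg (Nat.cast (R := ℝ)) h1
      rwa [Nat.cast_mul, Nat.cast_sub hq1.le, Nat.cast_sub (Nat.one_le_pow _ _ (by omega)),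
        Nat.cast_pow, Nat.cast_one] at this
    linear_combination h2
  have hsqrt : (q : ℝ) ^ f * √((q : ℝ) ^ f) ^ m
      = (q : ℝ) ^ 2 * (q : ℝ) ^ (((k : ℝ) + f) / 2 - 2) := by
    rw [← Real.rpow_natCast (q : ℝ) 2, ← Real.rpow_add hq0, Real.sqrt_eq_rpow,
      ← Real.rpow_natCast (q : ℝ) f, ← Real.rpow_mul hq0.le, ← Real.rpow_mul_natCast hq0.le,
      ← Real.rpow_add hq0]
    congr 1
    rw [hkfm]
    push_cast
    ring
  have hpow : (q : ℝ) ^ f * (q : ℝ) ^ k = (q : ℝ) ^ 2 * (q : ℝ) ^ (f + k - 2) := by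
    rw [← pow_add, ← pow_add]
    congr 1
    omega
  have hK1 : (0 : ℝ) < (q : ℝ) ^ f - 1 := sub_pos.mpr (one_lt_pow₀ hqR (by omega))
  rw [hm, Nat.add_sub_cancel, card_middle hq hf, card_middle hq hk, hq] at h
  push_cast at h
  rw [div_le_iff₀ hK1]
  refine le_of_mul_le_mul_left ?_ (pow_pos hq0 2)
  calc (q : ℝ) ^ 2 * (((q : ℝ) - 1) * (q : ℝ) ^ (f + k - 2)
        - ((q : ℝ) ^ f - q) * (q : ℝ) ^ (((k : ℝ) + f) / 2 - 2))
      = ((q : ℝ) - 1) * (q : ℝ) ^ f * ((q : ℝ) ^ k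
          - (((trivialOnBase F K).card : ℝ) - 1) * √((q : ℝ) ^ f) ^ m) := by
        linear_combination (-((q : ℝ) - 1)) * hpow
          + (((trivialOnBase F K).card : ℝ) - 1) * ((q : ℝ) - 1) * hsqrt
          + (q : ℝ) ^ 2 * (q : ℝ) ^ (((k : ℝ) + f) / 2 - 2) * hT
    _ ≤ _ := h
    _ = _ := by ring

/-- The minimum distance is the least weight of a nonzero codeword, to which `weight_lower_bound`
applies. -/
theorem exists_isLinearCode (hf1 : 1 < f) : ∃ δ : ℕ,
    IsLinearCode (code F d) (q ^ (f - 1) * (q ^ k - 1) / (q ^ f - 1)) k δ ∧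
      (((q : ℝ) - 1) * (q : ℝ) ^ (f + k - 2)
        - ((q : ℝ) ^ f - q) * (q : ℝ) ^ (((k : ℝ) + f) / 2 - 2)) / ((q : ℝ) ^ f - 1)
        ≤ (δ : ℝ) := by
  classical
  obtain ⟨b, hb, hmin⟩ := Finset.exists_min_image ((Finset.univ : Finset L).erase 0)
    (fun b => hammingNorm (codeword F d b)) ⟨1, by simp⟩
  have hb0 := Finset.ne_of_mem_erase hb
  refine ⟨_, ?_, weight_lower_bound hd_inj ha hd hgcd hq hf hk hf1 hb0⟩
  rw [← length_eq hd_inj ha hd hgcd hq hf hk, ← hk]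
  exact isLinearCode_code (fun b hb => weight_pos hd_inj ha hd hgcd hb)
    (fun b' hb' => hmin b' (Finset.mem_erase.mpr ⟨hb', Finset.mem_univ _⟩)) ⟨b, hb0, rfl⟩

/-- `weight_eq` with the characters trivial on `Fˣ` listed as the powers of a generator `φ`. -/
theorem weight_eq_gaussSum_powers (hf1 : 1 < f) {φ : MulChar K ℂ}
    (hφ : orderOf φ = (q ^ f - 1) / (q - 1)) {b : L} (hb : b ≠ 0) :
    ∃ β : K, algebraMap K L β = b ^ ((q ^ k - 1) / (q ^ f - 1)) ∧
      (hammingNorm (codeword F d b) : ℂ) =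
        ((q : ℂ) - 1) * (q : ℂ) ^ (f + k - 2) / ((q : ℂ) ^ f - 1)
        + (-1) ^ (k / f - 1) * ((q : ℂ) - 1) * (q : ℂ) ^ (f - 2) / ((q : ℂ) ^ f - 1)
          * ∑ j ∈ Finset.Icc 1 ((q ^ f - 1) / (q - 1) - 1),
              (φ ^ j) (-1)
              * gaussSum (φ ^ j) (canonicalAddChar K) ^ (k / f - 1)
              * (starRingEnd ℂ) ((φ ^ j) β) := by
  classical
  obtain ⟨ψ, hψ, hcan⟩ := exists_canonicalAddChar_eq F K
  have hq1 : 1 < q := hq ▸ Fintype.one_lt_card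
  have hm : k / f = Module.finrank K L := by
    rw [← hk, ← hf, ← Module.finrank_mul_finrank F K L,
      Nat.mul_div_cancel_left _ Module.finrank_pos]
  refine ⟨Algebra.norm K b, ?_, ?_⟩
  · rw [FiniteField.algebraMap_norm_eq_pow, Nat.card_eq_fintype_card, Nat.card_eq_fintype_card,
      card_middle hq hf, card_middle hq hk]
  have h := weight_eq hd_inj ha hd hgcd hψ hb
  rw [← card_middle (F := F) (K := K) hq hf, ← hq] at hφ
  rw [sum_trivialOnBase_erase_eq_sum_pow F hφ, ← hm, ← hcan, card_middle (F := F) (K := K) hq hf,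
    card_middle (F := F) (K := L) hq hk, hq] at h
  simp only [starRingEnd_apply, MulChar.star_apply']
  set S := ∑ j ∈ Finset.Icc 1 ((q ^ f - 1) / (q - 1) - 1),
    (φ ^ j) (-1) * gaussSum (φ ^ j) (canonicalAddChar K) ^ (k / f - 1)
      * (φ ^ j)⁻¹ (Algebra.norm K b) with hS
  obtain ⟨e, rfl⟩ : ∃ e, f = e + 2 := ⟨f - 2, by omega⟩
  have hq0 : (q : ℂ) ≠ 0 := by exact_mod_cast (by omega : q ≠ 0)
  have hK1 : (q : ℂ) ^ (e + 2) - 1 ≠ 0 :=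
    sub_ne_zero.mpr (by exact_mod_cast (Nat.one_lt_pow (by omega) hq1).ne')
  have he : e + 2 + k - 2 = e + k := by omega
  rw [he, Nat.add_sub_cancel, div_mul_eq_mul_div, ← add_div, eq_div_iff hK1]
  apply mul_left_cancel₀ (pow_ne_zero 2 hq0)
  push_cast at h
  linear_combination h

/-- The two-weight code obtained from a quadratic extension `K` of `F`. The parity of
`m = k / 2 - 1` decides which of the two weights is the smaller one. -/
theorem weights_quadratic (hf2 : f = 2) {m : ℕ} (hm : Module.finrank K L = m + 1) {w₁ w₂ : ℕ}
    (hw₁ : ((q : ℤ) + 1) * w₁ = (q : ℤ) ^ k + (-1) ^ m * (q : ℤ) ^ (m + 1))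
    (hw₂ : ((q : ℤ) + 1) * w₂ = (q : ℤ) ^ k - (-1) ^ m * (q : ℤ) ^ m) :
    IsLinearCode (code F d) (q * (q ^ k - 1) / (q ^ 2 - 1)) k (min w₁ w₂) ∧
    IsWeightCode (code F d) 2 ∧
    weightEnumerator (code F d) = 1 + ((q ^ k - 1) / (q + 1)) • X ^ w₁
      + (q * (q ^ k - 1) / (q + 1)) • X ^ w₂ := by
  classical
  have hq1 : 1 < q := hq ▸ Fintype.one_lt_card
  have hk0 : 0 < k := hk ▸ Module.finrank_pos
  have hqk : 1 < q ^ k := Nat.one_lt_pow hk0.ne' hq1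
  obtain ⟨P, hP, hcount, h₁, h₂⟩ := exists_weight_quadratic hd_inj ha hd hm hgcd (hf.trans hf2)
  have hcL : (Fintype.card L : ℤ) = (q : ℤ) ^ k := by rw [card_middle hq hk]; push_cast; rfl
  rw [hq, hcL] at h₁ h₂
  rw [hq] at hcount
  have hpos : ∀ b : L, b ≠ 0 → 0 < hammingNorm (codeword F d b) :=
    fun b hb => weight_pos hd_inj ha hd hgcd hb
  have hq1' : ((q : ℤ) + 1) ≠ 0 := by positivity
  have h₁' : ∀ b : L, b ≠ 0 → P b → hammingNorm (codeword F d b) = w₁ := fun b hb hPb => by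
    exact_mod_cast mul_left_cancel₀ hq1' ((h₁ b hb hPb).trans hw₁.symm)
  have h₂' : ∀ b : L, b ≠ 0 → ¬ P b → hammingNorm (codeword F d b) = w₂ := fun b hb hPb => by
    exact_mod_cast mul_left_cancel₀ hq1' ((h₂ b hb hPb).trans hw₂.symm)
  have hne : w₁ ≠ w₂ := by
    rintro rfl
    have h := hw₁.symm.trans hw₂
    have h3 : (-1 : ℤ) ^ m * (q : ℤ) ^ m * (q + 1) = 0 := by linear_combination h
    have hq0 : (q : ℤ) ≠ 0 := by exact_mod_cast (by omega : q ≠ 0)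
    exact mul_ne_zero (mul_ne_zero (pow_ne_zero _ (by norm_num)) (pow_ne_zero _ hq0)) hq1' h3
  set N₁ := (Finset.univ.filter fun b : L => b ≠ 0 ∧ P b).card with hN₁
  set N₂ := (Finset.univ.filter fun b : L => b ≠ 0 ∧ ¬ P b).card with hN₂
  rw [card_middle hq hk] at hcount
  have hadd : N₁ + N₂ = q ^ k - 1 := by
    have h := Finset.card_filter_add_card_filter_not (s := Finset.univ.filter fun b : L => b ≠ 0) P
    rw [Finset.filter_filter, Finset.filter_filter, Finset.filter_ne',
      Finset.card_erase_of_mem (Finset.mem_univ _), Finset.card_univ, card_middle hq hk] at h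
    exact h
  have hcount₂ : (q + 1) * N₂ = q * (q ^ k - 1) := by
    have : (q + 1) * (N₁ + N₂) = (q + 1) * (q ^ k - 1) := by rw [hadd]
    nlinarith
  have hN₁0 : 0 < N₁ := by
    rcases Nat.eq_zero_or_pos N₁ with h | h
    · rw [h] at hcount; omega
    · exact h
  have hN₂0 : 0 < N₂ := by
    rcases Nat.eq_zero_or_pos N₂ with h | h
    · rw [h, mul_zero] at hcount₂
      have := Nat.mul_pos (by omega : 0 < q) (by omega : 0 < q ^ k - 1)
      omega
    · exact h
  have hN₁eq : (q ^ k - 1) / (q + 1) = N₁ :=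
    Nat.div_eq_of_eq_mul_right (by omega) hcount.symm
  have hN₂eq : q * (q ^ k - 1) / (q + 1) = N₂ :=
    Nat.div_eq_of_eq_mul_right (by omega) hcount₂.symm
  have htwo := twoWeight_code hpos hne P h₁' h₂' hN₁.symm hN₂.symm hN₁0 hN₂0
  rw [hN₁eq, hN₂eq]
  refine ⟨?_, htwo⟩
  have hn := length_eq hd_inj ha hd hgcd hq hf hk
  rw [hf2, pow_one] at hn
  rw [← hn, ← hk]
  obtain ⟨b₁, hb₁⟩ := Finset.card_pos.mp hN₁0
  obtain ⟨b₂, hb₂⟩ := Finset.card_pos.mp hN₂0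
  rw [Finset.mem_filter] at hb₁ hb₂
  refine isLinearCode_code hpos (fun b hb => ?_) ?_
  · by_cases hPb : P b
    · rw [h₁' b hb hPb]; exact min_le_left _ _
    · rw [h₂' b hb hPb]; exact min_le_right _ _
  · rcases min_choice w₁ w₂ with h | h
    · exact ⟨b₁, hb₁.2.1, by rw [h, h₁' b₁ hb₁.2.1 hb₁.2.2]⟩
    · exact ⟨b₂, hb₂.2.1, by rw [h, h₂' b₂ hb₂.2.1 hb₂.2.2]⟩

end Parameters

/-! ### Integrality of the two weights -/

section Divisibility

theorem exists_mul_eq_pow_sub_pow (q : ℕ) {m e : ℕ} (he : e % 2 = 0) (hme : e ≤ m) :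
    ∃ w, (q + 1) * w = q ^ m - q ^ (m - e) := by
  obtain ⟨r, rfl⟩ : ∃ r, e = 2 * r := ⟨e / 2, by omega⟩
  have h : q + 1 ∣ q ^ (2 * r) - 1 := by
    rw [pow_mul]
    refine Dvd.dvd.trans ?_ (by simpa using Nat.sub_dvd_pow_sub_pow (q ^ 2) 1 r)
    exact ⟨q - 1, by rw [← Nat.sq_sub_sq, one_pow]⟩
  obtain ⟨w, hw⟩ := h.mul_left (q ^ (m - 2 * r))
  refine ⟨w, ?_⟩
  rw [← hw, Nat.mul_sub, ← pow_add, Nat.sub_add_cancel hme, mul_one]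

theorem exists_mul_eq_pow_add_pow (q : ℕ) {m e : ℕ} (he : e % 2 = 1) (hme : e ≤ m) :
    ∃ w, (q + 1) * w = q ^ m + q ^ (m - e) := by
  have h : q + 1 ∣ q ^ e + 1 := by
    simpa using (Nat.odd_iff.mpr he).nat_add_dvd_pow_add_pow q 1
  obtain ⟨w, hw⟩ := h.mul_left (q ^ (m - e))
  refine ⟨w, ?_⟩
  rw [← hw, Nat.mul_add, ← pow_add, Nat.sub_add_cancel hme, mul_one]

end Divisibility

end TraceCode

end

theorem theorem2
    {F K L : Type*} [Field F] [Fintype F] [DecidableEq F] [Field K] [Fintype K]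
    [Field L] [Fintype L] [Algebra F K] [Algebra K L] [Algebra F L] [IsScalarTower F K L]
    (q f k : ℕ) (hq : Fintype.card F = q) (hf : Module.finrank F K = f)
    (hk : Module.finrank F L = k) (hfk : f ∣ k) (hgcd : Nat.gcd (k / f) (q - 1) = 1)
    (a : F) (ha : a ≠ 0)
    -- an enumeration `d_1, …, d_n` of the defining set
    (n : ℕ) (d : Fin n → L) (hd_inj : Function.Injective d)
    (hd : Set.range d = TraceCode.definingSet F K a) :
    (f = 1 →
      TraceCode.IsOptimalCode (TraceCode.code F d) ((q ^ k - 1) / (q - 1)) k (q ^ (k - 1)) ∧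
      TraceCode.AchievesGriesmer (TraceCode.code F d) ((q ^ k - 1) / (q - 1)) k (q ^ (k - 1)) ∧
      TraceCode.IsWeightCode (TraceCode.code F d) 1) ∧
    (1 < f →
      (∃ δ : ℕ,
        TraceCode.IsLinearCode (TraceCode.code F d)
          (q ^ (f - 1) * (q ^ k - 1) / (q ^ f - 1)) k δ ∧
        (((q : ℝ) - 1) * (q : ℝ) ^ (f + k - 2)
            - ((q : ℝ) ^ f - q) * (q : ℝ) ^ (((k : ℝ) + f) / 2 - 2)) / ((q : ℝ) ^ f - 1)
          ≤ (δ : ℝ)) ∧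
      (∀ φ : MulChar K ℂ, orderOf φ = (q ^ f - 1) / (q - 1) →
        ∀ b : L, b ≠ 0 →
          -- `β` is `b ^ ((q ^ k - 1) / (q ^ f - 1))`, seen in the subfield `K` of `L`
          ∃ β : K, algebraMap K L β = b ^ ((q ^ k - 1) / (q ^ f - 1)) ∧
            (hammingNorm (TraceCode.codeword F d b) : ℂ) =
              ((q : ℂ) - 1) * (q : ℂ) ^ (f + k - 2) / ((q : ℂ) ^ f - 1)
              + (-1) ^ (k / f - 1) * ((q : ℂ) - 1) * (q : ℂ) ^ (f - 2) / ((q : ℂ) ^ f - 1)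
                * ∑ j ∈ Finset.Icc 1 ((q ^ f - 1) / (q - 1) - 1),
                    (φ ^ j) (-1)
                    * gaussSum (φ ^ j) (TraceCode.canonicalAddChar K) ^ (k / f - 1)
                    * (starRingEnd ℂ) ((φ ^ j) β))) ∧
    (f = 2 → k % 4 = 0 →
      TraceCode.IsLinearCode (TraceCode.code F d)
        (q * (q ^ k - 1) / (q ^ 2 - 1)) k ((q ^ k - q ^ (k / 2)) / (q + 1)) ∧
      TraceCode.IsWeightCode (TraceCode.code F d) 2 ∧
      TraceCode.weightEnumerator (TraceCode.code F d) =
        1 + ((q ^ k - 1) / (q + 1)) • Polynomial.X ^ ((q ^ k - q ^ (k / 2)) / (q + 1))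
          + (q * (q ^ k - 1) / (q + 1)) •
              Polynomial.X ^ ((q ^ k + q ^ (k / 2 - 1)) / (q + 1))) ∧
    (f = 2 → k % 4 = 2 →
      TraceCode.IsLinearCode (TraceCode.code F d)
        (q * (q ^ k - 1) / (q ^ 2 - 1)) k ((q ^ k - q ^ (k / 2 - 1)) / (q + 1)) ∧
      TraceCode.IsWeightCode (TraceCode.code F d) 2 ∧
      TraceCode.weightEnumerator (TraceCode.code F d) =
        1 + (q * (q ^ k - 1) / (q + 1)) •
              Polynomial.X ^ ((q ^ k - q ^ (k / 2 - 1)) / (q + 1))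
          + ((q ^ k - 1) / (q + 1)) • Polynomial.X ^ ((q ^ k + q ^ (k / 2)) / (q + 1))) := by
  have hfpos : 0 < f := hf ▸ Module.finrank_pos
  have hkpos : 0 < k := hk ▸ Module.finrank_pos
  have hq1 : 1 < q := hq ▸ Fintype.one_lt_card
  have hkf : k = f * Module.finrank K L := by rw [← hk, ← hf, Module.finrank_mul_finrank]
  have hm : k / f = Module.finrank K L := by rw [hkf, Nat.mul_div_cancel_left _ hfpos]
  have hgcd' : Nat.gcd (Module.finrank K L) (Fintype.card F - 1) = 1 := by rw [← hm, hq, hgcd]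
  refine ⟨fun hf1 => TraceCode.oneWeight_code hd_inj ha hd hgcd' hq hf hk hf1,
    fun hf1 => ⟨TraceCode.exists_isLinearCode hd_inj ha hd hgcd' hq hf hk hf1,
      fun φ hφ b hb =>
        TraceCode.weight_eq_gaussSum_powers hd_inj ha hd hgcd' hq hf hk hf1 hφ hb⟩, ?_, ?_⟩
  · intro hf2 hk4
    obtain ⟨m, hm1⟩ := Nat.exists_eq_add_one.mpr (Module.finrank_pos (R := K) (M := L))
    rw [hf2, hm1] at hkf
    have hk2 : k / 2 = m + 1 := by omega
    -- `k / 2` is even, so the sign in `weights_quadratic` is negative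
    have hodd : (-1 : ℤ) ^ m = -1 := Odd.neg_one_pow (Nat.odd_iff.mpr (by omega))
    obtain ⟨w₁, hw₁⟩ := TraceCode.exists_mul_eq_pow_sub_pow q (m := k) (e := m + 1)
      (by omega) (by omega)
    obtain ⟨w₂, hw₂⟩ := TraceCode.exists_mul_eq_pow_add_pow q (m := k) (e := m + 2)
      (by omega) (by omega)
    rw [show k - (m + 1) = m + 1 by omega] at hw₁
    rw [show k - (m + 2) = m by omega] at hw₂
    have hle : q ^ (m + 1) ≤ q ^ k := Nat.pow_le_pow_right (by omega) (by omega)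
    have e₁ : (q ^ k - q ^ (m + 1)) / (q + 1) = w₁ :=
      Nat.div_eq_of_eq_mul_right (by omega) hw₁.symm
    have e₂ : (q ^ k + q ^ m) / (q + 1) = w₂ := Nat.div_eq_of_eq_mul_right (by omega) hw₂.symm
    have hmin : min w₁ w₂ = w₁ := by
      refine min_eq_left ?_
      rw [← e₁, ← e₂]
      exact Nat.div_le_div_right (by omega)
    have h := TraceCode.weights_quadratic hd_inj ha hd hgcd' hq hf hk hf2 hm1 (w₁ := w₁) (w₂ := w₂)
      (by
        have := congrArg (Nat.cast (R := ℤ)) hw₁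
        rw [Nat.cast_sub hle] at this
        push_cast at this
        rw [hodd, this]; ring)
      (by
        have := congrArg (Nat.cast (R := ℤ)) hw₂
        push_cast at this
        rw [hodd, this]; ring)
    rw [hmin] at h
    rw [hk2, Nat.add_sub_cancel, e₁, e₂]
    exact h
  · intro hf2 hk4
    obtain ⟨m, hm1⟩ := Nat.exists_eq_add_one.mpr (Module.finrank_pos (R := K) (M := L))
    rw [hf2, hm1] at hkf
    have hk2 : k / 2 = m + 1 := by omega
    -- `k / 2` is odd, so the sign in `weights_quadratic` is positive
    have heven : (-1 : ℤ) ^ m = 1 := Even.neg_one_pow (Nat.even_iff.mpr (by omega))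
    obtain ⟨w₁, hw₁⟩ := TraceCode.exists_mul_eq_pow_add_pow q (m := k) (e := m + 1)
      (by omega) (by omega)
    obtain ⟨w₂, hw₂⟩ := TraceCode.exists_mul_eq_pow_sub_pow q (m := k) (e := m + 2)
      (by omega) (by omega)
    rw [show k - (m + 1) = m + 1 by omega] at hw₁
    rw [show k - (m + 2) = m by omega] at hw₂
    have hle : q ^ m ≤ q ^ k := Nat.pow_le_pow_right (by omega) (by omega)
    have e₁ : (q ^ k + q ^ (m + 1)) / (q + 1) = w₁ :=
      Nat.div_eq_of_eq_mul_right (by omega) hw₁.symm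
    have e₂ : (q ^ k - q ^ m) / (q + 1) = w₂ := Nat.div_eq_of_eq_mul_right (by omega) hw₂.symm
    have hmin : min w₁ w₂ = w₂ := by
      refine min_eq_right ?_
      rw [← e₁, ← e₂]
      exact Nat.div_le_div_right (by omega)
    have h := TraceCode.weights_quadratic hd_inj ha hd hgcd' hq hf hk hf2 hm1 (w₁ := w₁) (w₂ := w₂)
      (by
        have := congrArg (Nat.cast (R := ℤ)) hw₁
        push_cast at this
        rw [heven, this]; ring)
      (by
        have := congrArg (Nat.cast (R := ℤ)) hw₂
        rw [Nat.cast_sub hle] at this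
        push_cast at this
        rw [heven, this]; ring)
    rw [hmin] at h
    rw [hk2, Nat.add_sub_cancel, e₁, e₂, add_right_comm]
    exact h
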